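/- **Theorem (stable tangent bundle of $P_T$).** Let $k\ge 1$, $\ell\ge 0$, and let $m_1,\dots,m_k,n_1,\dots,n_\ell\ge 0$ be integers. Put $S(m_1,\dots,m_k)=S^{m_1}\times\cdots\times S^{m_k}$ and let $P_T=P_T(m_1,\dots,m_k;n_1,\dots,n_\ell)$ be the smooth manifold $$P_T=\bigl(S(m_1,\dots,m_k)\times \mathbb{C}P^{n_1}\times\cdots\times\mathbb{C}P^{n_\ell}\bigr)/\mathbb{Z}_2,$$ where $\mathbb{Z}_2$ acts freely by $(\mathbf x,w)\mapsto(-\mathbf x,\overline{w})$ (antipodal map on every sphere, complex conjugation on every projective space). Let $\varepsilon$ be the trivial real line bundle over $P_T$. Let $\eta$ be the projection to $P_T$ of $$\bigl(S(m_1,\dots,m_k)\times \textstyle\prod_i\mathbb{C}P^{n_i}\times\mathbb{R}\bigr)/\bigl((\mathbf x,w,t)\sim(-\mathbf x,\overline w,-t)\bigr).$$ For $1\le j\le \ell$ let $\zeta'_j$ be the projection to $P_T$, $[\mathbf x,\mathbf y,z]\mapsto[\mathbf x,[y_1],\dots,[y_\ell]]$, of the quotient of $S(m_1,\dots,m_k)\times\prod_i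 S^{2n_i+1}\times\mathbb{C}$ (with $S^{2n_i+1}\subset\mathbb{C}^{n_i+1}$ the unit sphere) by the identifications $$(\mathbf x,\mathbf y,z)\sim(\mathbf x,h\mathbf y,h_jz)\sim(-\mathbf x,\overline{h\mathbf y},\overline{h_jz}),\qquad h=(h_1,\dots,h_\ell)\in(S^1)^\ell,\quad h\mathbf y=(h_1y_1,\dots,h_\ell y_\ell).$$ Then $\eta$ is a real line bundle, every $\zeta'_j$ is a real $2$-plane bundle, and there is an isomorphism of real vector bundles over $P_T$ $$T P_T\oplus \ell\,\eta\oplus(k+\ell)\,\varepsilon\;\cong\;\Bigl(\sum_{i=1}^k(m_i+1)\Bigr)\eta\oplus(n_1+1)\zeta'_1\oplus\cdots\oplus(n_\ell+1)\zeta'_\ell .$$ -/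

import Mathlib

open Set Topology Bundle
open scoped Manifold ContDiff LinearAlgebra.Projectivization

noncomputable section

namespace ProjProd

section Pi

variable {ι : Type} [Fintype ι] {E : ι → Type} [∀ i, NormedAddCommGroup (E i)]
  [∀ i, NormedSpace ℝ (E i)] {M : ι → Type} [∀ i, TopologicalSpace (M i)]
  [∀ i, ChartedSpace (E i) (M i)]

variable (E M) in
/-- The product atlas on a finite product, with the model space spelled `∀ i, E i`. -/
@[reducible] def piCharts : ChartedSpace (∀ i, E i) (∀ i, M i) := piChartedSpace E M

theorem isManifold_pi (h : ∀ i, IsManifold 𝓘(ℝ, E i) ∞ (M i)) :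
    let _ := piCharts E M
    IsManifold 𝓘(ℝ, ∀ i, E i) ∞ (∀ i, M i) := by
  let _ := piCharts E M
  apply isManifold_of_contDiffOn
  rintro _ _ ⟨e, he, rfl⟩ ⟨e', he', rfl⟩
  simp only [modelWithCornersSelf_coe, modelWithCornersSelf_coe_symm, preimage_id, range_id,
    inter_univ, Function.id_comp, Function.comp_id]
  rw [contDiffOn_pi]
  intro i
  have hi := (contDiffGroupoid ∞ 𝓘(ℝ, E i)).compatible (he i (mem_univ i)) (he' i (mem_univ i))
  rw [contDiffGroupoid, mem_groupoid_of_pregroupoid] at hi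
  have hi := hi.1
  simp only [contDiffPregroupoid, modelWithCornersSelf_coe, modelWithCornersSelf_coe_symm,
    preimage_id, range_id, inter_univ, Function.id_comp, Function.comp_id] at hi
  refine hi.comp (ContinuousLinearMap.proj (R := ℝ) (φ := E) i).contDiff.contDiffOn ?_
  intro x hx
  exact ⟨hx.1 i (mem_univ i), hx.2 i (mem_univ i)⟩

theorem contMDiff_pi (h : ∀ i, IsManifold 𝓘(ℝ, E i) ∞ (M i)) (f : ∀ i, M i → M i)
    (hf : ∀ i, ContMDiff 𝓘(ℝ, E i) 𝓘(ℝ, E i) ∞ (f i)) :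
    let _ := piCharts E M
    ContMDiff 𝓘(ℝ, ∀ i, E i) 𝓘(ℝ, ∀ i, E i) ∞ (fun x : ∀ i, M i => fun i => f i (x i)) := by
  let _ := piCharts E M
  have := isManifold_pi h
  rw [contMDiff_iff]
  refine ⟨continuous_pi fun i => (hf i).continuous.comp (continuous_apply i), fun x y => ?_⟩
  rw [contDiffOn_pi]
  intro i
  have hi := (contMDiff_iff.1 (hf i)).2 (x i) (y i)
  refine hi.comp (ContinuousLinearMap.proj (R := ℝ) (φ := E) i).contDiff.contDiffOn ?_
  intro z hz
  simp only [mfld_simps] at hz ⊢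
  exact ⟨hz.1 i (mem_univ i), hz.2 i (mem_univ i)⟩

end Pi

theorem isManifold_quotient {E : Type} [NormedAddCommGroup E] [NormedSpace ℝ E]
    {M : Type} [TopologicalSpace M] [ChartedSpace E M] [IsManifold 𝓘(ℝ, E) ∞ M]
    [T2Space M] [LocallyCompactSpace M]
    {G : Type} [Group G] [MulAction G M] [ProperlyDiscontinuousSMul G M]
    [ContinuousConstSMul G M] [IsCancelSMul G M]
    (h : ∀ g : G, ContMDiff 𝓘(ℝ, E) 𝓘(ℝ, E) ∞ (fun x : M => g • x)) :
    IsManifold 𝓘(ℝ, E) ∞ (MulAction.orbitRel.Quotient G M) := by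
  have hq : IsLocalHomeomorph (Quotient.mk _ : M → MulAction.orbitRel.Quotient G M) :=
    (isQuotientCoveringMap_quotientMk_of_properlyDiscontinuousSMul
      (G := G) (E := M)).isCoveringMap.isLocalHomeomorph
  have key : ∀ e ∈ atlas E (MulAction.orbitRel.Quotient G M),
      ∃ p : M, e = (hq.localInverseAt (x := p)).trans (chartAt E p) := by
    rintro _ ⟨a, rfl⟩
    exact ⟨_, rfl⟩
  apply isManifold_of_contDiffOn
  intro e e' he he'
  obtain ⟨p, rfl⟩ := key e he
  obtain ⟨p', rfl⟩ := key e' he'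
  simp only [modelWithCornersSelf_coe, modelWithCornersSelf_coe_symm, preimage_id, range_id,
    inter_univ, Function.id_comp, Function.comp_id]
  intro x hx
  obtain ⟨⟨hx1, hx2⟩, hx3, hx4⟩ := hx
  set y : M := (chartAt E p).symm x with hy
  set s := hq.localInverseAt (x := p') with hs
  have hmk : (hq.localInverseAt (x := p)).symm y = Quotient.mk _ y := by
    rw [IsLocalHomeomorph.localInverseAt_symm]
  change (hq.localInverseAt (x := p)).symm y ∈ s.source at hx3
  change s ((hq.localInverseAt (x := p)).symm y) ∈ (chartAt E p').source at hx4
  rw [hmk] at hx3 hx4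
  have hss : ∀ z ∈ s.target, s (Quotient.mk _ z) = z := by
    intro z hz
    have := s.right_inv hz
    rwa [hs, IsLocalHomeomorph.localInverseAt_symm, ← hs] at this
  have hqs : (Quotient.mk (MulAction.orbitRel G M) (s (Quotient.mk _ y))) = Quotient.mk _ y :=
    hq.apply_localInverseAt_of_mem hx3
  obtain ⟨g, hg⟩ : ∃ g : G, g • y = s (Quotient.mk _ y) := Quotient.exact hqs
  have hgt : g • y ∈ s.target := hg ▸ s.map_source hx3
  apply ContDiffAt.contDiffWithinAt
  have c1 : ContMDiffAt 𝓘(ℝ, E) 𝓘(ℝ, E) ∞ (chartAt E p).symm x :=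
    (contMDiffOn_chart_symm (I := 𝓘(ℝ, E)) (n := ∞) (x := p)).contMDiffAt
      ((chartAt E p).open_target.mem_nhds hx1)
  have c2 : ContMDiffAt 𝓘(ℝ, E) 𝓘(ℝ, E) ∞ (chartAt E p') (g • y) :=
    (contMDiffOn_chart (I := 𝓘(ℝ, E)) (n := ∞) (x := p')).contMDiffAt
      ((chartAt E p').open_source.mem_nhds (by rw [hg]; exact hx4))
  have c3 : ContMDiffAt 𝓘(ℝ, E) 𝓘(ℝ, E) ∞
      (fun w => chartAt E p' (g • (chartAt E p).symm w)) x :=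
    ContMDiffAt.comp x c2 (((h g).contMDiffAt (x := y)).comp x c1)
  refine c3.contDiffAt.congr_of_eventuallyEq ?_
  have cc : ContinuousAt (fun w => g • (chartAt E p).symm w) x :=
    (((h g).contMDiffAt (x := y)).comp x c1).continuousAt
  filter_upwards [cc.preimage_mem_nhds (s.open_target.mem_nhds hgt)] with w hw
  have e1 : Quotient.mk (MulAction.orbitRel G M) ((chartAt E p).symm w)
      = Quotient.mk _ (g • (chartAt E p).symm w) :=
    (Quotient.sound (show MulAction.orbitRel G M _ _ from ⟨g, rfl⟩)).symm
  have e2 := hss _ hw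
  simp only [OpenPartialHomeomorph.coe_trans, OpenPartialHomeomorph.coe_trans_symm,
    Function.comp_apply, IsLocalHomeomorph.localInverseAt_symm]
  rw [e1]
  exact congrArg _ e2

/-- Complex projective space `ℂPⁿ`, with the quotient topology and the standard affine charts. -/
def CP (n : ℕ) : Type := ℙ ℂ (EuclideanSpace ℂ (Fin (n + 1)))

namespace CP

variable {n : ℕ}

/-- The nonzero vectors of `ℂⁿ⁺¹`. -/
abbrev Vec (n : ℕ) : Type := {v : EuclideanSpace ℂ (Fin (n + 1)) // v ≠ 0}

/-- The class `[v] ∈ ℂPⁿ` of a nonzero vector. -/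
def mk (v : Vec n) : CP n := Projectivization.mk' ℂ v

instance : TopologicalSpace (CP n) := inferInstanceAs (TopologicalSpace (Quotient _))

theorem mk_surjective : Function.Surjective (mk : Vec n → CP n) := Quotient.mk_surjective

theorem mk_eq_iff {v w : Vec n} : mk v = mk w ↔ ∃ a : ℂ, ∀ i, a * w.1 i = v.1 i := by
  refine (Projectivization.mk_eq_mk_iff' ℂ v.1 w.1 v.2 w.2).trans (exists_congr fun a => ?_)
  constructor
  · intro h i
    rw [← h]; rfl
  · intro h
    ext i
    exact h i

theorem exists_coord (v : Vec n) : ∃ i, v.1 i ≠ 0 := by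
  by_contra! h
  exact v.2 (by ext i; exact h i)

theorem scalar_ne_zero {v w : Vec n} {a : ℂ} (h : ∀ i, a * w.1 i = v.1 i) : a ≠ 0 := by
  rintro rfl
  obtain ⟨i, hi⟩ := exists_coord v
  exact hi (by rw [← h i, zero_mul])

theorem continuous_mk : Continuous (mk : Vec n → CP n) := continuous_quot_mk

theorem isOpenQuotientMap_mk : IsOpenQuotientMap (mk : Vec n → CP n) := by
  refine ⟨mk_surjective, continuous_mk, fun U hU => ?_⟩
  have : IsOpen ((mk : Vec n → CP n) ⁻¹' (mk '' U)) := by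
    have e : (mk : Vec n → CP n) ⁻¹' (mk '' U) = ⋃ a : {a : ℂ // a ≠ 0},
        (fun v : Vec n => (⟨a.1 • v.1, smul_ne_zero a.2 v.2⟩ : Vec n)) ⁻¹' U := by
      ext v
      simp only [mem_preimage, mem_image, mem_iUnion]
      constructor
      · rintro ⟨w, hw, h⟩
        obtain ⟨a, ha⟩ := mk_eq_iff.1 h
        refine ⟨⟨a, scalar_ne_zero ha⟩, ?_⟩
        have : (⟨a • v.1, smul_ne_zero (scalar_ne_zero ha) v.2⟩ : Vec n) = w :=
          Subtype.ext (by ext i; exact ha i)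
        rwa [this]
      · rintro ⟨a, ha⟩
        exact ⟨_, ha, mk_eq_iff.2 ⟨a.1, fun i => rfl⟩⟩
    rw [e]
    refine isOpen_iUnion fun a => hU.preimage ?_
    exact (continuous_subtype_val.const_smul a.1).subtype_mk _
  exact this

instance : T2Space (CP n) := by
  rw [t2Space_iff_of_isOpenQuotientMap isOpenQuotientMap_mk]
  have e : {q : Vec n × Vec n | mk q.1 = mk q.2} =
      ⋂ i, ⋂ j, {q : Vec n × Vec n | q.1.1 i * q.2.1 j = q.1.1 j * q.2.1 i} := by
    ext ⟨v, w⟩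
    simp only [mem_ofPred_eq, mem_iInter, mk_eq_iff]
    constructor
    · rintro ⟨a, ha⟩ i j
      rw [← ha i, ← ha j]; ring
    · intro h
      obtain ⟨i, hi⟩ := exists_coord w
      refine ⟨v.1 i / w.1 i, fun j => ?_⟩
      rw [div_mul_eq_mul_div, div_eq_iff hi]
      exact h i j
  rw [e]
  refine isClosed_iInter fun i => isClosed_iInter fun j => isClosed_eq ?_ ?_ <;> fun_prop

/-- The affine coordinates `[v] ↦ (v k / v i)_{k ≠ i}`. -/
def affineFun (i : Fin (n + 1)) (p : CP n) : Fin n → ℂ :=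
  Quotient.lift (fun v : Vec n => fun k => v.1 (i.succAbove k) / v.1 i) (by
    intro v w h
    obtain ⟨a, ha⟩ := mk_eq_iff.1 (Quotient.sound h : mk v = mk w)
    funext k
    simp only [← ha]
    exact mul_div_mul_left _ _ (scalar_ne_zero ha)) p

theorem affineFun_mk (i : Fin (n + 1)) (v : Vec n) (k : Fin n) :
    affineFun i (mk v) k = v.1 (i.succAbove k) / v.1 i := rfl

/-- The domain `{[v] | v i ≠ 0}` of the `i`-th affine chart. -/
def affineDomain (i : Fin (n + 1)) : Set (CP n) := mk '' {v | v.1 i ≠ 0}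

theorem mk_mem_affineDomain {i : Fin (n + 1)} {v : Vec n} :
    mk v ∈ affineDomain i ↔ v.1 i ≠ 0 := by
  constructor
  · rintro ⟨w, hw, h⟩
    obtain ⟨a, ha⟩ := mk_eq_iff.1 h
    intro h0
    exact hw (by rw [← ha, h0, mul_zero])
  · exact fun h => ⟨v, h, rfl⟩

/-- The vector with `i`-th coordinate `1` and remaining coordinates `w`. -/
def affineVec (i : Fin (n + 1)) (w : Fin n → ℂ) : Vec n :=
  ⟨WithLp.toLp 2 (i.insertNth (1 : ℂ) w : Fin (n + 1) → ℂ), fun h => by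
    have := congrArg (fun v : EuclideanSpace ℂ (Fin (n + 1)) => v i) h
    simp at this⟩

@[simp] theorem affineVec_same (i : Fin (n + 1)) (w : Fin n → ℂ) : (affineVec i w).1 i = 1 := by
  simp [affineVec]

@[simp] theorem affineVec_succAbove (i : Fin (n + 1)) (w : Fin n → ℂ) (k : Fin n) :
    (affineVec i w).1 (i.succAbove k) = w k := by
  simp [affineVec]

theorem continuous_affineVec (i : Fin (n + 1)) : Continuous (affineVec (n := n) i) := by
  refine Continuous.subtype_mk ?_ _
  refine (PiLp.continuous_toLp 2 _).comp ?_
  exact Continuous.finInsertNth i continuous_const continuous_id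

/-- The `i`-th affine chart of `ℂPⁿ`. -/
def affineChart (i : Fin (n + 1)) : OpenPartialHomeomorph (CP n) (Fin n → ℂ) where
  toFun := affineFun i
  invFun w := mk (affineVec i w)
  source := affineDomain i
  target := univ
  map_source' _ _ := mem_univ _
  map_target' w _ := mk_mem_affineDomain.2 (by simp)
  left_inv' := by
    rintro _ ⟨v, hv, rfl⟩
    refine mk_eq_iff.2 ⟨(v.1 i)⁻¹, fun k => ?_⟩
    induction k using i.succAboveCases with
    | x => rw [affineVec_same, inv_mul_cancel₀ hv]
    | p k => rw [affineVec_succAbove, affineFun_mk, div_eq_inv_mul]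
  right_inv' w _ := by
    funext k
    simp [affineFun_mk]
  open_source := isOpenQuotientMap_mk.isOpenMap _ (isOpen_ne_fun (by fun_prop) (by fun_prop))
  open_target := isOpen_univ
  continuousOn_toFun := by
    have hq : IsOpen {v : Vec n | v.1 i ≠ 0} := isOpen_ne_fun (by fun_prop) (by fun_prop)
    rintro _ ⟨v, hv, rfl⟩
    apply ContinuousAt.continuousWithinAt
    rw [isOpenQuotientMap_mk.continuousAt_comp_iff.symm]
    refine continuousAt_pi.2 fun k => ?_
    exact ContinuousAt.div (by fun_prop) (by fun_prop) hv
  continuousOn_invFun := (continuous_mk.comp (continuous_affineVec i)).continuousOn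

theorem exists_mem_affineDomain (p : CP n) : ∃ i, p ∈ affineDomain i := by
  obtain ⟨v, rfl⟩ := mk_surjective p
  obtain ⟨i, hi⟩ := exists_coord v
  exact ⟨i, mk_mem_affineDomain.2 hi⟩

instance : ChartedSpace (Fin n → ℂ) (CP n) where
  atlas := range affineChart
  chartAt p := affineChart (exists_mem_affineDomain p).choose
  mem_chart_source p := (exists_mem_affineDomain p).choose_spec
  chart_mem_atlas _ := mem_range_self _

theorem contDiff_affineVec (i j : Fin (n + 1)) :
    ContDiff ℝ ∞ (fun w : Fin n → ℂ => (affineVec i w).1 j) := by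
  induction j using i.succAboveCases with
  | x => simp only [affineVec_same]; exact contDiff_const
  | p k => simp only [affineVec_succAbove]; exact contDiff_apply ℝ ℂ k

instance : IsManifold 𝓘(ℝ, Fin n → ℂ) ∞ (CP n) := by
  apply isManifold_of_contDiffOn
  rintro _ _ ⟨i, rfl⟩ ⟨j, rfl⟩
  simp only [modelWithCornersSelf_coe, modelWithCornersSelf_coe_symm, preimage_id, range_id,
    inter_univ, Function.id_comp, Function.comp_id]
  rw [contDiffOn_pi]
  intro k
  have : ∀ w ∈ ((affineChart i).symm ≫ₕ affineChart j).source, (affineVec i w).1 j ≠ 0 :=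
    fun w hw => mk_mem_affineDomain.1 hw.2
  have hd := ((contDiff_affineVec i (j.succAbove k)).contDiffOn).mul
    ((contDiff_affineVec i j).contDiffOn.inv this)
  exact hd.congr fun w hw => div_eq_mul_inv _ _

/-- Coordinatewise complex conjugation of a nonzero vector. -/
def conjVec (v : Vec n) : Vec n :=
  ⟨WithLp.toLp 2 fun i => (starRingEnd ℂ) (v.1 i), fun h => by
    obtain ⟨i, hi⟩ := exists_coord v
    have := congrArg (fun v : EuclideanSpace ℂ (Fin (n + 1)) => v i) h
    simp at this
    exact hi this⟩

@[simp] theorem conjVec_apply (v : Vec n) (i : Fin (n + 1)) :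
    (conjVec v).1 i = (starRingEnd ℂ) (v.1 i) := rfl

/-- Complex conjugation `[z₀ : … : zₙ] ↦ [z̄₀ : … : z̄ₙ]` on `ℂPⁿ`. -/
def conj (p : CP n) : CP n :=
  Quotient.lift (fun v : Vec n => mk (conjVec v)) (by
    intro v w h
    obtain ⟨a, ha⟩ := mk_eq_iff.1 (Quotient.sound h : mk v = mk w)
    exact mk_eq_iff.2 ⟨(starRingEnd ℂ) a, fun i => by simp [← ha]⟩) p

theorem conj_mk (v : Vec n) : conj (mk v) = mk (conjVec v) := rfl

@[simp] theorem conj_conj (p : CP n) : conj (conj p) = p := by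
  obtain ⟨v, rfl⟩ := mk_surjective p
  exact mk_eq_iff.2 ⟨1, fun i => by simp⟩

theorem continuous_conj : Continuous (conj : CP n → CP n) := by
  refine Continuous.quotient_lift (continuous_mk.comp ?_) _
  refine Continuous.subtype_mk ((PiLp.continuous_toLp 2 _).comp ?_) _
  refine continuous_pi fun i => Complex.continuous_conj.comp (by fun_prop)

theorem contMDiff_conj :
    ContMDiff 𝓘(ℝ, Fin n → ℂ) 𝓘(ℝ, Fin n → ℂ) ∞ (conj : CP n → CP n) := by
  rw [contMDiff_iff]
  refine ⟨continuous_conj, fun x y => ?_⟩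
  have hc : ∀ z : CP n, extChartAt 𝓘(ℝ, Fin n → ℂ) z =
      (affineChart (exists_mem_affineDomain z).choose).toPartialEquiv := fun z => by
    simp only [mfld_simps]; rfl
  rw [hc, hc]
  generalize (exists_mem_affineDomain x).choose = i
  generalize (exists_mem_affineDomain y).choose = j
  rw [contDiffOn_pi]
  intro k
  have hne : ∀ w : Fin n → ℂ, conj (mk (affineVec i w)) ∈ affineDomain j →
      (affineVec i w).1 j ≠ 0 := fun w hw h => by
    rw [conj_mk, mk_mem_affineDomain, conjVec_apply, h, map_zero] at hw
    exact hw rfl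
  have hd := Complex.conjCLE.contDiff.comp_contDiffOn
    (((contDiff_affineVec i (j.succAbove k)).contDiffOn (s := {w | (affineVec i w).1 j ≠ 0})).mul
      ((contDiff_affineVec i j).contDiffOn.inv fun w hw => hw))
  refine (hd.mono (fun w hw => hne w hw.2)).congr fun w hw => ?_
  change (starRingEnd ℂ) ((affineVec i w).1 (j.succAbove k)) / (starRingEnd ℂ) ((affineVec i w).1 j)
    = (starRingEnd ℂ) ((affineVec i w).1 (j.succAbove k) * ((affineVec i w).1 j)⁻¹)
  rw [map_mul, map_inv₀, div_eq_mul_inv]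

end CP

section Cover

variable {k l : ℕ} (m : Fin k → ℕ) (n : Fin l → ℕ)

/-- `S(m₁, …, m_k) = S^{m₁} × ⋯ × S^{m_k}`. -/
abbrev SphereProd : Type := ∀ i, Metric.sphere (0 : EuclideanSpace ℝ (Fin (m i + 1))) 1

/-- `ℂP^{n₁} × ⋯ × ℂP^{n_l}`. -/
abbrev CPProd : Type := ∀ j, CP (n j)

/-- `S(m₁, …, m_k) × ℂP^{n₁} × ⋯ × ℂP^{n_l}`, a double cover of `P_T`. -/
def Cover : Type := SphereProd m × CPProd n

/-- The space on which `Cover m n` and `PT m n` are modelled. -/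
abbrev ModelE : Type := (∀ i, EuclideanSpace ℝ (Fin (m i))) × (∀ j, Fin (n j) → ℂ)

namespace Cover

instance : TopologicalSpace (Cover m n) := inferInstanceAs (TopologicalSpace (_ × _))

instance : T2Space (Cover m n) := inferInstanceAs (T2Space (SphereProd m × CPProd n))

/-- The product manifold structure. -/
instance : ChartedSpace (ModelE m n) (Cover m n) :=
  let _ : ChartedSpace (∀ i, EuclideanSpace ℝ (Fin (m i))) (SphereProd m) := piCharts _ _
  let _ : ChartedSpace (∀ j, Fin (n j) → ℂ) (CPProd n) := piCharts _ _
  prodChartedSpace _ (SphereProd m) _ (CPProd n)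

instance : IsManifold 𝓘(ℝ, ModelE m n) ∞ (Cover m n) := by
  let _ : ChartedSpace (∀ i, EuclideanSpace ℝ (Fin (m i))) (SphereProd m) := piCharts _ _
  let _ : ChartedSpace (∀ j, Fin (n j) → ℂ) (CPProd n) := piCharts _ _
  have h1 : IsManifold 𝓘(ℝ, ∀ i, EuclideanSpace ℝ (Fin (m i))) ∞ (SphereProd m) :=
    isManifold_pi (E := fun i => EuclideanSpace ℝ (Fin (m i))) fun i => inferInstance
  have h2 : IsManifold 𝓘(ℝ, ∀ j, Fin (n j) → ℂ) ∞ (CPProd n) :=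
    isManifold_pi (E := fun j => Fin (n j) → ℂ) fun j => inferInstance
  rw [modelWithCornersSelf_prod]
  exact IsManifold.prod (SphereProd m) (CPProd n)

instance : LocallyCompactSpace (Cover m n) :=
  ChartedSpace.locallyCompactSpace (ModelE m n) (Cover m n)

variable {m n}

/-- The involution `(x₁, …, x_k, w₁, …, w_l) ↦ (-x₁, …, -x_k, w̄₁, …, w̄_l)`. -/
def invol (a : Cover m n) : Cover m n := (fun i => -a.1 i, fun j => (a.2 j).conj)

@[simp] theorem invol_invol (a : Cover m n) : invol (invol a) = a :=
  Prod.ext (funext fun _ => neg_neg _) (funext fun _ => CP.conj_conj _)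

theorem contMDiff_invol :
    ContMDiff 𝓘(ℝ, ModelE m n) 𝓘(ℝ, ModelE m n) ∞ (invol : Cover m n → Cover m n) := by
  let _ : ChartedSpace (∀ i, EuclideanSpace ℝ (Fin (m i))) (SphereProd m) := piCharts _ _
  let _ : ChartedSpace (∀ j, Fin (n j) → ℂ) (CPProd n) := piCharts _ _
  have h1 : ContMDiff 𝓘(ℝ, ∀ i, EuclideanSpace ℝ (Fin (m i)))
      𝓘(ℝ, ∀ i, EuclideanSpace ℝ (Fin (m i))) ∞ (fun x : SphereProd m => fun i => -x i) :=
    contMDiff_pi (E := fun i => EuclideanSpace ℝ (Fin (m i))) (fun i => inferInstance)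
      (fun i x => -x) fun i => by
        have := Fact.mk (@finrank_euclideanSpace_fin ℝ _ (m i + 1))
        exact contMDiff_neg_sphere
  have h2 : ContMDiff 𝓘(ℝ, ∀ j, Fin (n j) → ℂ) 𝓘(ℝ, ∀ j, Fin (n j) → ℂ) ∞
      (fun w : CPProd n => fun j => (w j).conj) :=
    contMDiff_pi (E := fun j => Fin (n j) → ℂ) (fun j => inferInstance)
      (fun j => CP.conj) fun j => CP.contMDiff_conj
  rw [modelWithCornersSelf_prod]
  exact h1.prodMap h2

/-- The action of `ℤ₂ = {1, -1}` in which `-1` acts by `invol`. -/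
instance : MulAction ℤˣ (Cover m n) where
  smul u a := if u = 1 then a else invol a
  one_smul a := if_pos rfl
  mul_smul u v a := by
    change (if u * v = 1 then a else invol a) =
      if u = 1 then (if v = 1 then a else invol a) else invol (if v = 1 then a else invol a)
    rcases Int.units_eq_one_or u with rfl | rfl <;> rcases Int.units_eq_one_or v with rfl | rfl <;>
      simp

theorem neg_one_smul (a : Cover m n) : (-1 : ℤˣ) • a = invol a := if_neg (by decide)

theorem contMDiff_smul (u : ℤˣ) :
    ContMDiff 𝓘(ℝ, ModelE m n) 𝓘(ℝ, ModelE m n) ∞ (fun a : Cover m n => u • a) := by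
  rcases Int.units_eq_one_or u with rfl | rfl
  · simp only [one_smul]; exact contMDiff_id
  · simpa only [neg_one_smul] using contMDiff_invol

instance : ContinuousConstSMul ℤˣ (Cover m n) := ⟨fun u => (contMDiff_smul u).continuous⟩

theorem sphere_ne_neg [NeZero k] (x : SphereProd m) : ¬ ∀ i, x i = -x i := by
  intro h
  have h1 : (x 0 : EuclideanSpace ℝ (Fin (m 0 + 1))) = 0 := by
    ext i
    have := congrArg (fun x : Metric.sphere (0 : EuclideanSpace ℝ (Fin (m 0 + 1))) 1 => x.1 i) (h 0)
    simp only [coe_neg_sphere, PiLp.neg_apply] at this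
    rw [PiLp.zero_apply]
    linarith
  have h2 := (x 0).2
  rw [h1] at h2
  simp at h2

theorem invol_ne [NeZero k] (a : Cover m n) : invol a ≠ a := fun h =>
  sphere_ne_neg a.1 fun i => (congrFun (congrArg Prod.fst h) i).symm

instance [NeZero k] : IsCancelSMul ℤˣ (Cover m n) where
  left_cancel' u a b h := by simpa using congrArg (u⁻¹ • ·) h
  right_cancel' u v a h := by
    rcases Int.units_eq_one_or u with rfl | rfl <;>
      rcases Int.units_eq_one_or v with rfl | rfl <;> try rfl
    · rw [one_smul, neg_one_smul] at h; exact absurd h.symm (invol_ne a)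
    · rw [one_smul, neg_one_smul] at h; exact absurd h (invol_ne a)

end Cover

/-- The manifold `P_T(m₁, …, m_k; n₁, …, n_l) = (S(m₁, …, m_k) × ∏ ℂP^{n_j}) / ℤ₂`. -/
def PT : Type := MulAction.orbitRel.Quotient ℤˣ (Cover m n)

namespace PT

instance : TopologicalSpace (PT m n) := inferInstanceAs (TopologicalSpace (Quotient _))

/-- The manifold structure for which `Cover m n → PT m n` is a local diffeomorphism. -/
instance [NeZero k] : ChartedSpace (ModelE m n) (PT m n) :=
  inferInstanceAs (ChartedSpace (ModelE m n) (MulAction.orbitRel.Quotient ℤˣ (Cover m n)))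

instance [NeZero k] : IsManifold 𝓘(ℝ, ModelE m n) ∞ (PT m n) :=
  isManifold_quotient (G := ℤˣ) Cover.contMDiff_smul

variable {m n}

/-- The double covering `S(m₁, …, m_k) × ∏ ℂP^{n_j} → P_T`. -/
def mk (a : Cover m n) : PT m n := Quotient.mk _ a

theorem mk_surjective : Function.Surjective (mk : Cover m n → PT m n) := Quotient.mk_surjective

theorem mk_eq_iff {a b : Cover m n} : mk a = mk b ↔ a = b ∨ a = b.invol := by
  refine Quotient.eq.trans (MulAction.orbitRel_apply.trans ?_)
  constructor
  · rintro ⟨u, rfl⟩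
    rcases Int.units_eq_one_or u with rfl | rfl
    · exact Or.inl (one_smul _ _)
    · exact Or.inr (Cover.neg_one_smul b)
  · rintro (rfl | rfl)
    · exact MulAction.mem_orbit_self _
    · exact ⟨-1, Cover.neg_one_smul b⟩

end PT

end Cover

section Bundles

/-- An identification on `Y × V` which covers a surjection `q : Y → B` and identifies the copies
of the vector space `V` over any two points of one fibre of `q` by a linear isomorphism. The
quotient of `Y × V` is then the total space of a family of vector spaces over `B`. -/
structure Identification {Y B : Type} (q : Y → B) (V : Type) [AddCommGroup V] [Module ℝ V] where
  /-- The identification. -/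
  rel : Setoid (Y × V)
  surj : Function.Surjective q
  proj_eq : ∀ {a b : Y × V}, rel a b → q a.1 = q b.1
  linear : ∀ y y' : Y, q y = q y' → ∃ A : V ≃ₗ[ℝ] V, ∀ v v' : V, rel (y, v) (y', v') ↔ v' = A v

namespace Identification

variable {Y B : Type} {q : Y → B} {V : Type} [AddCommGroup V] [Module ℝ V]
  (R : Identification q V)

/-- The identification space `(Y × V) / ∼`. -/
def Tot : Type := Quotient R.rel

/-- The bundle projection `[y, v] ↦ q y`. -/
def proj : R.Tot → B := Quotient.lift (fun a => q a.1) fun _ _ h => R.proj_eq h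

/-- The fibre of the identification space over `b`. -/
def Fiber (b : B) : Type := {e : R.Tot // R.proj e = b}

/-- The fibre over `q y` is identified with `V` through `v ↦ [y, v]`. -/
def fiberEquiv (y : Y) {b : B} (hy : q y = b) : V ≃ R.Fiber b :=
  Equiv.ofBijective (fun v => ⟨Quotient.mk R.rel (y, v), hy⟩) (by
    constructor
    · intro v w h
      obtain ⟨A, hA⟩ := R.linear y y rfl
      have h1 := (hA v w).1 (Quotient.exact (congrArg Subtype.val h))
      have h2 := (hA v v).1 (R.rel.refl _)
      exact h2.trans h1.symm
    · rintro ⟨e, he⟩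
      obtain ⟨⟨y', v'⟩, rfl⟩ := Quotient.exists_rep e
      obtain ⟨A, hA⟩ := R.linear y' y (he.trans hy.symm)
      exact ⟨A v', Subtype.ext (Quotient.sound (R.rel.symm ((hA _ _).2 rfl)))⟩)

/-- A point of `Y` over `b`. -/
def rep (b : B) : Y := (R.surj b).choose

theorem q_rep (b : B) : q (R.rep b) = b := (R.surj b).choose_spec

instance (b : B) : AddCommGroup (R.Fiber b) :=
  (R.fiberEquiv (R.rep b) (R.q_rep b)).symm.addCommGroup

instance (b : B) : Module ℝ (R.Fiber b) :=
  (R.fiberEquiv (R.rep b) (R.q_rep b)).symm.module ℝ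

/-- All the maps `v ↦ [y, v]` are linear, so that the vector space structure of a fibre does not
depend on the chosen point of `Y`. -/
def fiberLinearEquiv (y : Y) {b : B} (hy : q y = b) : V ≃ₗ[ℝ] R.Fiber b :=
  (R.linear y (R.rep b) (hy.trans (R.q_rep b).symm)).choose.trans
    ((R.fiberEquiv (R.rep b) (R.q_rep b)).symm.linearEquiv ℝ).symm

theorem fiberLinearEquiv_apply (y : Y) {b : B} (hy : q y = b) (v : V) :
    R.fiberLinearEquiv y hy v = ⟨Quotient.mk R.rel (y, v), hy⟩ := by
  have hA := (R.linear y (R.rep b) (hy.trans (R.q_rep b).symm)).choose_spec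
  exact Subtype.ext (Quotient.sound (R.rel.symm ((hA v _).2 rfl)))

variable [TopologicalSpace Y] [TopologicalSpace V]

instance : TopologicalSpace R.Tot := inferInstanceAs (TopologicalSpace (Quotient R.rel))

instance (b : B) : TopologicalSpace (R.Fiber b) :=
  inferInstanceAs (TopologicalSpace {e : R.Tot // R.proj e = b})

/-- The quotient topology of the identification space, on the disjoint union of its fibres. -/
instance : TopologicalSpace (TotalSpace V R.Fiber) :=
  TopologicalSpace.induced (fun e => (e.2.1 : R.Tot)) inferInstance

end Identification

/-- The finite Whitney sum `⨁ᵢ E i`. -/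
@[reducible] def WhitneySum {B ι : Type} (E : ι → B → Type) : B → Type := fun b => ∀ i, E i b

/-- The topology of the total space of a Whitney sum, as the fibre product of the `E i` over `B`. -/
instance WhitneySum.topologicalSpace {B ι : Type} [TopologicalSpace B] (F : ι → Type)
    (E : ι → B → Type) [∀ i, TopologicalSpace (TotalSpace (F i) (E i))] :
    TopologicalSpace (TotalSpace (∀ i, F i) (WhitneySum E)) :=
  TopologicalSpace.induced
    (fun p => (p.1, fun i => (⟨p.1, p.2 i⟩ : TotalSpace (F i) (E i))))
    (inferInstance : TopologicalSpace (B × ∀ i, TotalSpace (F i) (E i)))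

/-- `E` is a real vector bundle with model fibre `F`. -/
def IsRealVectorBundle {B : Type} [TopologicalSpace B] (F : Type) [NormedAddCommGroup F]
    [NormedSpace ℝ F] (E : B → Type) [TopologicalSpace (TotalSpace F E)]
    [∀ b, TopologicalSpace (E b)] [∀ b, AddCommGroup (E b)] [∀ b, Module ℝ (E b)] : Prop :=
  ∃ _ : FiberBundle F E, VectorBundle ℝ F E

/-- Isomorphisms of real vector bundles over the identity of `B`: fibrewise linear
homeomorphisms of total spaces. -/
structure BundleIso {B : Type} (F₁ : Type) (E₁ : B → Type) (F₂ : Type) (E₂ : B → Type)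
    [TopologicalSpace (TotalSpace F₁ E₁)] [TopologicalSpace (TotalSpace F₂ E₂)]
    [∀ b, AddCommGroup (E₁ b)] [∀ b, Module ℝ (E₁ b)]
    [∀ b, AddCommGroup (E₂ b)] [∀ b, Module ℝ (E₂ b)] where
  /-- The linear isomorphism of the fibres over `b`. -/
  equiv : ∀ b, E₁ b ≃ₗ[ℝ] E₂ b
  continuous_toFun :
    Continuous fun e : TotalSpace F₁ E₁ => (⟨e.1, equiv e.1 e.2⟩ : TotalSpace F₂ E₂)
  continuous_invFun :
    Continuous fun e : TotalSpace F₂ E₂ => (⟨e.1, (equiv e.1).symm e.2⟩ : TotalSpace F₁ E₁)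

end Bundles

section PTBundles

open scoped ComplexConjugate

variable {k l : ℕ} [NeZero k] (m : Fin k → ℕ) (n : Fin l → ℕ)

/-- The canonical line bundle `η` over `P_T`: the quotient of `S(m₁, …, m_k) × ∏ ℂP^{n_j} × ℝ` by
`(x, w, t) ∼ (-x, w̄, -t)`. -/
def eta : Identification (PT.mk : Cover m n → PT m n) ℝ where
  rel :=
    { r := fun a b => (b.1 = a.1 ∧ b.2 = a.2) ∨ (b.1 = a.1.invol ∧ b.2 = -a.2)
      iseqv := by
        refine ⟨fun a => Or.inl ⟨rfl, rfl⟩, ?_, ?_⟩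
        · rintro a b (⟨h, h'⟩ | ⟨h, h'⟩)
          · exact Or.inl ⟨h.symm, h'.symm⟩
          · exact Or.inr ⟨by rw [h, Cover.invol_invol], by rw [h', neg_neg]⟩
        · rintro a b c (⟨h, h'⟩ | ⟨h, h'⟩) (⟨g, g'⟩ | ⟨g, g'⟩)
          · exact Or.inl ⟨g.trans h, g'.trans h'⟩
          · exact Or.inr ⟨by rw [g, h], by rw [g', h']⟩
          · exact Or.inr ⟨by rw [g, h], by rw [g', h']⟩
          · exact Or.inl ⟨by rw [g, h, Cover.invol_invol], by rw [g', h', neg_neg]⟩ }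
  surj := PT.mk_surjective
  proj_eq := by
    rintro a b (⟨h, -⟩ | ⟨h, -⟩)
    · exact congrArg PT.mk h.symm
    · exact PT.mk_eq_iff.2 (Or.inr (by rw [h, Cover.invol_invol]))
  linear := by
    intro y y' hy
    rcases PT.mk_eq_iff.1 hy with rfl | rfl
    · refine ⟨LinearEquiv.refl ℝ ℝ, fun v v' => ⟨?_, fun h => Or.inl ⟨rfl, h⟩⟩⟩
      rintro (⟨-, h⟩ | ⟨h, -⟩)
      · exact h
      · exact absurd h.symm (Cover.invol_ne y)
    · refine ⟨LinearEquiv.neg ℝ, fun v v' =>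
        ⟨?_, fun h => Or.inr ⟨(Cover.invol_invol y').symm, h⟩⟩⟩
      rintro (⟨h, -⟩ | ⟨-, h⟩)
      · exact absurd h.symm (Cover.invol_ne y')
      · exact h

/-- `∏ S^{2n_j+1}`, with `S^{2n_j+1}` the unit sphere of `ℂ^{n_j+1}`. -/
abbrev OddSphereProd : Type :=
  ∀ j, Metric.sphere (0 : EuclideanSpace ℂ (Fin (n j + 1))) 1

/-- The quotient map `S^{2n+1} → ℂPⁿ`. -/
def CP.ofSphere {n : ℕ} (u : Metric.sphere (0 : EuclideanSpace ℂ (Fin (n + 1))) 1) : CP n :=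
  CP.mk ⟨u.1, ne_zero_of_mem_unit_sphere u⟩

theorem CP.ofSphere_surjective {n : ℕ} : Function.Surjective (CP.ofSphere (n := n)) := by
  intro p
  obtain ⟨v, rfl⟩ := CP.mk_surjective p
  have hv : ‖v.1‖ ≠ 0 := norm_ne_zero_iff.2 v.2
  refine ⟨⟨((‖v.1‖ : ℂ)⁻¹) • v.1, ?_⟩, CP.mk_eq_iff.2 ⟨(‖v.1‖ : ℂ)⁻¹, fun i => rfl⟩⟩
  rw [mem_sphere_zero_iff_norm, norm_smul, norm_inv, Complex.norm_real, norm_norm,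
    inv_mul_cancel₀ hv]

theorem CP.ofSphere_eq_iff {n : ℕ} {u v : Metric.sphere (0 : EuclideanSpace ℂ (Fin (n + 1))) 1} :
    CP.ofSphere u = CP.ofSphere v ↔ ∃ h : Circle, ∀ s, v.1 s = h * u.1 s := by
  constructor
  · intro e
    obtain ⟨a, ha⟩ := CP.mk_eq_iff.1 e.symm
    have h1 : a • u.1 = v.1 := by ext i; exact ha i
    have h2 := congrArg norm h1
    rw [norm_smul, norm_eq_of_mem_sphere, norm_eq_of_mem_sphere, mul_one] at h2
    exact ⟨⟨a, mem_sphere_zero_iff_norm.2 h2⟩, fun s => (ha s).symm⟩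
  · rintro ⟨h, hh⟩
    exact (CP.mk_eq_iff.2 ⟨h, fun i => (hh i).symm⟩).symm

/-- Complex conjugation on `S^{2n+1}`. -/
def conjSphere {n : ℕ} (u : Metric.sphere (0 : EuclideanSpace ℂ (Fin (n + 1))) 1) :
    Metric.sphere (0 : EuclideanSpace ℂ (Fin (n + 1))) 1 :=
  ⟨WithLp.toLp 2 fun i => conj (u.1 i), by
    have h := norm_eq_of_mem_sphere u
    rw [EuclideanSpace.norm_eq] at h
    rw [mem_sphere_zero_iff_norm, EuclideanSpace.norm_eq]
    simpa using h⟩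

theorem CP.conj_ofSphere {n : ℕ} (u : Metric.sphere (0 : EuclideanSpace ℂ (Fin (n + 1))) 1) :
    CP.conj (CP.ofSphere u) = CP.ofSphere (conjSphere u) := rfl

theorem circle_eq_of_mul {n : ℕ} (u : Metric.sphere (0 : EuclideanSpace ℂ (Fin (n + 1))) 1)
    {g h : Circle} (e : ∀ s, (g : ℂ) * u.1 s = h * u.1 s) : g = h := by
  obtain ⟨s, hs⟩ := CP.exists_coord ⟨u.1, ne_zero_of_mem_unit_sphere u⟩
  exact Circle.ext (mul_right_cancel₀ hs (e s))

/-- The map `S(m₁, …, m_k) × ∏ S^{2n_j+1} → P_T`, `(x, y) ↦ [x, [y₁], …, [y_l]]`. -/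
def hopf (a : SphereProd m × OddSphereProd n) : PT m n :=
  PT.mk (a.1, fun j => CP.ofSphere (a.2 j))

/-- The real 2-plane bundle `ζ'_j` over `P_T`: the quotient of
`S(m₁, …, m_k) × ∏ S^{2n_i+1} × ℂ` by
`(x, y, z) ∼ (x, h y, h_j z) ∼ (-x, conj (h y), conj (h_j z))` for `h = (h₁, …, h_l) ∈ (S¹)^l`,
which acts coordinatewise on `∏ S^{2n_i+1}`. -/
def zeta (j : Fin l) : Identification (hopf m n) ℂ where
  rel :=
    { r := fun a b => ∃ h : Fin l → Circle,
        ((∀ i, b.1.1 i = a.1.1 i) ∧ (∀ i s, (b.1.2 i).1 s = h i * (a.1.2 i).1 s) ∧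
          b.2 = h j * a.2) ∨
        ((∀ i, b.1.1 i = -a.1.1 i) ∧ (∀ i s, (b.1.2 i).1 s = conj (h i * (a.1.2 i).1 s)) ∧
          b.2 = conj (h j * a.2))
      iseqv := by
        have hc : ∀ (g : Circle) (z : ℂ), conj (g : ℂ) * (g * z) = z := fun g z => by
          rw [← Circle.coe_inv_eq_conj, ← mul_assoc, ← Circle.coe_mul, inv_mul_cancel,
            Circle.coe_one, one_mul]
        refine ⟨fun a => ⟨1, Or.inl ⟨fun _ => rfl, by simp, by simp⟩⟩, ?_, ?_⟩
        · rintro a b ⟨h, ⟨h1, h2, h3⟩ | ⟨h1, h2, h3⟩⟩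
          · refine ⟨h⁻¹, Or.inl ⟨fun i => (h1 i).symm, fun i s => ?_, ?_⟩⟩
            · rw [h2, Pi.inv_apply, Circle.coe_inv_eq_conj, hc]
            · rw [h3, Pi.inv_apply, Circle.coe_inv_eq_conj, hc]
          · refine ⟨h, Or.inr ⟨fun i => ?_, fun i s => ?_, ?_⟩⟩
            · rw [h1, neg_neg]
            · rw [h2, map_mul, Complex.conj_conj, hc]
            · rw [h3, map_mul, Complex.conj_conj, hc]
        · rintro a b c ⟨h, ⟨h1, h2, h3⟩ | ⟨h1, h2, h3⟩⟩ ⟨g, ⟨g1, g2, g3⟩ | ⟨g1, g2, g3⟩⟩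
          · refine ⟨g * h, Or.inl ⟨fun i => by rw [g1, h1], fun i s => ?_, ?_⟩⟩
            · rw [g2, h2, Pi.mul_apply, Circle.coe_mul, mul_assoc]
            · rw [g3, h3, Pi.mul_apply, Circle.coe_mul, mul_assoc]
          · refine ⟨g * h, Or.inr ⟨fun i => by rw [g1, h1], fun i s => ?_, ?_⟩⟩
            · rw [g2, h2, Pi.mul_apply, Circle.coe_mul, mul_assoc]
            · rw [g3, h3, Pi.mul_apply, Circle.coe_mul, mul_assoc]
          · refine ⟨g⁻¹ * h, Or.inr ⟨fun i => by rw [g1, h1], fun i s => ?_, ?_⟩⟩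
            · rw [g2, h2, Pi.mul_apply, Circle.coe_mul, Pi.inv_apply, Circle.coe_inv_eq_conj,
                mul_assoc, map_mul conj (conj _), Complex.conj_conj]
            · rw [g3, h3, Pi.mul_apply, Circle.coe_mul, Pi.inv_apply, Circle.coe_inv_eq_conj,
                mul_assoc, map_mul conj (conj _), Complex.conj_conj]
          · refine ⟨g⁻¹ * h, Or.inl ⟨fun i => by rw [g1, h1, neg_neg], fun i s => ?_, ?_⟩⟩
            · rw [g2, h2, Pi.mul_apply, Circle.coe_mul, Pi.inv_apply, Circle.coe_inv_eq_conj,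
                mul_assoc, map_mul, Complex.conj_conj]
            · rw [g3, h3, Pi.mul_apply, Circle.coe_mul, Pi.inv_apply, Circle.coe_inv_eq_conj,
                mul_assoc, map_mul, Complex.conj_conj] }
  surj := by
    intro p
    obtain ⟨⟨x, w⟩, rfl⟩ := PT.mk_surjective p
    choose u hu using fun j => CP.ofSphere_surjective (w j)
    exact ⟨(x, u), congrArg PT.mk (Prod.ext rfl (funext hu))⟩
  proj_eq := by
    rintro a b ⟨h, ⟨h1, h2, -⟩ | ⟨h1, h2, -⟩⟩
    · exact congrArg PT.mk (Prod.ext (funext fun i => (h1 i).symm)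
        (funext fun i => CP.ofSphere_eq_iff.2 ⟨h i, h2 i⟩))
    · refine PT.mk_eq_iff.2 (Or.inr (Prod.ext (funext fun i => ?_) (funext fun i => ?_)))
      · exact (neg_eq_iff_eq_neg.2 (h1 i)).symm
      · refine (CP.ofSphere_eq_iff (v := conjSphere (b.1.2 i))).2 ⟨h i, fun s => ?_⟩
        change conj ((b.1.2 i).1 s) = _
        rw [h2, Complex.conj_conj]
  linear := by
    rintro ⟨x, u⟩ ⟨x', u'⟩ hy
    have hx : ¬ ∀ i, x i = -x i := Cover.sphere_ne_neg x
    rcases PT.mk_eq_iff.1 hy with e | e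
    · obtain rfl : x = x' := congrArg Prod.fst e
      choose h hh using fun i => CP.ofSphere_eq_iff.1 (congrFun (congrArg Prod.snd e) i)
      refine ⟨(rotation (h j)).toLinearEquiv, fun v v' => ⟨?_, fun hv =>
        ⟨h, Or.inl ⟨fun _ => rfl, hh, hv⟩⟩⟩⟩
      rintro ⟨g, ⟨-, g2, g3⟩ | ⟨g1, -, -⟩⟩
      · have : g j = h j := circle_eq_of_mul (u j) fun s => (g2 j s).symm.trans (hh j s)
        exact this ▸ g3
      · exact absurd g1 hx
    · obtain rfl : x = fun i => -x' i := congrArg Prod.fst e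
      choose h hh using fun i => CP.ofSphere_eq_iff.1
        ((congrFun (congrArg Prod.snd e) i).trans (CP.conj_ofSphere (u' i)))
      have hh' : ∀ i s, (u' i).1 s = conj (h i * (u i).1 s) := fun i s => by
        rw [← hh i s]; exact (Complex.conj_conj _).symm
      refine ⟨(rotation (h j)).toLinearEquiv.trans Complex.conjLIE.toLinearEquiv, fun v v' =>
        ⟨?_, fun hv => ⟨h, Or.inr ⟨fun _ => (neg_neg _).symm, hh', hv⟩⟩⟩⟩
      rintro ⟨g, ⟨g1, -, -⟩ | ⟨-, g2, g3⟩⟩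
      · exact absurd (fun i => by rw [neg_neg]; exact (g1 i).symm) hx
      · have : g j = h j := circle_eq_of_mul (u j) fun s =>
          (starRingEnd ℂ).injective ((g2 j s).symm.trans (hh' j s))
        exact this ▸ g3

end PTBundles
end ProjProd

end

open ProjProd

namespace ProjProd

noncomputable section

open scoped ComplexConjugate

/-! ### Vector bundle structures on identification spaces. -/

namespace Identification

variable {Y B V : Type} [TopologicalSpace Y] [NormedAddCommGroup V] [NormedSpace ℝ V] {q : Y → B}
  {R : Identification q V}

/-! On a sphere, `(v, t) ↦ v + t x` identifies `T S^m ⊕ ε` with `m + 1` trivial lines. The antipodal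
map negates every component of `v + t x` and fixes `t`, so after dividing by the involution the
target is `(m + 1) η` and the added line is `ε`.

On `ℂPⁿ`, let `u` be a unit vector on a line and `P = u uᴴ` the projection onto it. A tangent vector
with variation `dP` of `P` goes to `dP u`, which is orthogonal to `u`; the complex multiples `(t + i
c) u` supply the missing direction. Replacing `u` by `h u` multiplies the `n + 1` components by `h`,
and complex conjugation conjugates them: these are the identifications of `ζ'`. The coefficient `t +
i c` is unchanged by `h` and conjugated by the involution, so `t` lives in `ε` and `c` in `η`. Each
projective factor thus uses one `η` and one `ε`, each sphere one `ε`.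

The sum of these maps over all factors is `modelMap`. It is bijective on a fibre by
`modelMap_injective` and a dimension count, `finrank_model`. For continuity, representatives in the
double cover and vectors `u` are chosen without any continuity. The choice of `u` disappears because
only the entries `u_s conj u_t` of `P` survive in the coordinates of `ζ'`; the choice of sheet
disappears by parity under the involution (`OddContinuous`), real parts being even and imaginary
parts odd. The inverse is continuous by `continuous_symm_of_frames`. That `η` and `ζ'` are vector
bundles is `Identification.isRealVectorBundle`, applied to explicit fibre coordinates. -/

theorem continuous_mk :
    Continuous fun a : Y × V => (⟨q a.1, R.fiberLinearEquiv a.1 rfl a.2⟩ :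
      TotalSpace V R.Fiber) := by
  refine continuous_induced_rng.2 ?_
  have e : ((fun x : TotalSpace V R.Fiber => (x.2.1 : R.Tot)) ∘ fun a : Y × V =>
      (⟨q a.1, R.fiberLinearEquiv a.1 rfl a.2⟩ : TotalSpace V R.Fiber)) = Quotient.mk R.rel := by
    funext a
    simp only [Function.comp_apply, fiberLinearEquiv_apply]
    rfl
  rw [e]
  exact continuous_quot_mk

theorem isInducing_totalSpaceMk (b : B) :
    IsInducing (TotalSpace.mk b : R.Fiber b → TotalSpace V R.Fiber) :=
  IsInducing.of_comp (g := fun e : TotalSpace V R.Fiber => (e.2.1 : R.Tot))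
    (continuous_induced_rng.2 continuous_subtype_val) continuous_induced_dom IsInducing.subtypeVal

variable [TopologicalSpace B]

/-- A fibrewise linear map from an identification space to `V` which is invertible over an open
subset of the base. -/
structure LocalCoord (R : Identification q V) where
  /-- The linear map on `{y} × V`. -/
  toFun : Y → V →L[ℝ] V
  continuous_toFun : Continuous toFun
  compat : ∀ {a b : Y × V}, R.rel a b → toFun a.1 a.2 = toFun b.1 b.2
  /-- The open set over which the map is invertible. -/
  domain : Set B
  isOpen_domain : IsOpen domain
  isInvertible : ∀ {y}, q y ∈ domain → (toFun y).IsInvertible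

theorem continuous_proj (hq : IsOpenQuotientMap q) :
    Continuous (TotalSpace.proj : TotalSpace V R.Fiber → B) := by
  have h : Continuous R.proj := (hq.continuous.comp continuous_fst).quotient_lift _
  have e : (TotalSpace.proj : TotalSpace V R.Fiber → B) = fun x => R.proj x.2.1 :=
    funext fun x => x.2.2.symm
  rw [e]
  exact h.comp continuous_induced_dom

namespace LocalCoord

variable (c : R.LocalCoord)

/-- The map on the identification space. -/
def lift : R.Tot → V := Quotient.lift (fun a => c.toFun a.1 a.2) fun _ _ h => c.compat h

/-- The map on the total space. -/
def eval (e : TotalSpace V R.Fiber) : V := c.lift e.2.1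

theorem continuous_eval : Continuous c.eval := by
  refine Continuous.comp ?_ continuous_induced_dom
  exact ((c.continuous_toFun.comp continuous_fst).clm_apply continuous_snd).quotient_lift _

theorem eval_mk (y : Y) {b : B} (hy : q y = b) (v : V) :
    c.eval ⟨b, R.fiberLinearEquiv y hy v⟩ = c.toFun y v := by
  rw [eval, fiberLinearEquiv_apply]
  rfl

theorem eval_eq (y : Y) {b : B} (hy : q y = b) (e : R.Fiber b) :
    c.eval ⟨b, e⟩ = c.toFun y ((R.fiberLinearEquiv y hy).symm e) := by
  rw [← c.eval_mk y hy, LinearEquiv.apply_symm_apply]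

theorem isLinearMap_eval (b : B) : IsLinearMap ℝ fun e : R.Fiber b => c.eval ⟨b, e⟩ := by
  simp only [c.eval_eq (R.rep b) (R.q_rep b)]
  exact ((c.toFun (R.rep b)).toLinearMap ∘ₗ
    (R.fiberLinearEquiv (R.rep b) (R.q_rep b)).symm.toLinearMap).isLinear

/-- The inverse of the local coordinate. -/
def inv (p : B × V) : TotalSpace V R.Fiber :=
  ⟨p.1, R.fiberLinearEquiv (R.rep p.1) (R.q_rep p.1) ((c.toFun (R.rep p.1)).inverse p.2)⟩

theorem eval_inv {p : B × V} (hp : p.1 ∈ c.domain) : c.eval (c.inv p) = p.2 := by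
  rw [inv, eval_mk]
  have h := c.isInvertible (y := R.rep p.1) (by rwa [R.q_rep])
  exact h.self_apply_inverse p.2

theorem eval_injective {b : B} (hb : b ∈ c.domain) :
    Function.Injective fun e : R.Fiber b => c.eval ⟨b, e⟩ := by
  intro e e' h
  simp only [c.eval_eq (R.rep b) (R.q_rep b)] at h
  exact (R.fiberLinearEquiv _ _).symm.injective
    ((c.isInvertible (y := R.rep b) (by rwa [R.q_rep])).injective h)

theorem inv_eval {e : TotalSpace V R.Fiber} (he : e.1 ∈ c.domain) : c.inv (e.1, c.eval e) = e := by
  have h := c.eval_inv (p := (e.1, c.eval e)) he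
  have h' := c.eval_injective he (a₁ := (c.inv (e.1, c.eval e)).2) (a₂ := e.2) h
  exact congrArg (TotalSpace.mk e.1) h'

/-- The arbitrary point `R.rep` in the definition of `inv` may be replaced by any point of the fibre
of `q`, since `eval` is injective there. Only in this form is continuity visible. -/
theorem inv_mk {y : Y} (hy : q y ∈ c.domain) (v : V) :
    c.inv (q y, v) = ⟨q y, R.fiberLinearEquiv y rfl ((c.toFun y).inverse v)⟩ := by
  refine congrArg (TotalSpace.mk (q y)) (c.eval_injective hy ?_)
  change c.eval (c.inv (q y, v)) = c.eval _
  rw [c.eval_inv hy, eval_mk]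
  exact ((c.isInvertible hy).self_apply_inverse v).symm

variable [CompleteSpace V]

/-- Continuity may be tested after pulling back along the open quotient map `q × id`. There `inv_mk`
exhibits the map as a composite of the quotient projection and the inversion of operators, which is
continuous at invertible operators because `V` is complete. -/
theorem continuousOn_inv (hq : IsOpenQuotientMap q) :
    ContinuousOn c.inv (c.domain ×ˢ univ) := by
  have hQ : IsOpenQuotientMap (Prod.map q (id : V → V)) := hq.prodMap .id
  rw [hQ.isQuotientMap.continuousOn_isOpen_iff (c.isOpen_domain.prod isOpen_univ)]
  have h : ContinuousOn (fun a : Y × V => (a.1, (c.toFun a.1).inverse a.2))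
      (Prod.map q (id : V → V) ⁻¹' c.domain ×ˢ univ) := by
    refine continuousOn_fst.prodMk (ContinuousOn.clm_apply ?_ continuousOn_snd)
    intro a ha
    exact ((c.isInvertible (y := a.1) ha.1).contDiffAt_map_inverse (n := 0)).continuousAt.comp
      (f := fun a : Y × V => c.toFun a.1)
      (c.continuous_toFun.comp continuous_fst).continuousAt |>.continuousWithinAt
  exact (continuous_mk.comp_continuousOn h).congr fun a ha => c.inv_mk ha.1 a.2

/-- The local trivialization given by a local coordinate. -/
def trivialization (hq : IsOpenQuotientMap q) :
    Trivialization V (TotalSpace.proj : TotalSpace V R.Fiber → B) where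
  toFun e := (e.1, c.eval e)
  invFun := c.inv
  source := TotalSpace.proj ⁻¹' c.domain
  target := c.domain ×ˢ univ
  map_source' _ he := ⟨he, mem_univ _⟩
  map_target' _ hp := hp.1
  left_inv' _ he := c.inv_eval he
  right_inv' _ hp := Prod.ext rfl (c.eval_inv hp.1)
  open_source := c.isOpen_domain.preimage (continuous_proj hq)
  open_target := c.isOpen_domain.prod isOpen_univ
  continuousOn_toFun := ((continuous_proj hq).prodMk c.continuous_eval).continuousOn
  continuousOn_invFun := c.continuousOn_inv hq
  baseSet := c.domain
  open_baseSet := c.isOpen_domain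
  source_eq := rfl
  target_eq := rfl
  proj_toFun _ _ := rfl

theorem isLinear_trivialization (hq : IsOpenQuotientMap q) :
    (c.trivialization hq).IsLinear ℝ := ⟨fun b _ => c.isLinearMap_eval b⟩

end LocalCoord

/-- The trivializations of the local coordinates form the atlas. As `V` is finite-dimensional,
continuity of a coordinate change in operator norm reduces to continuity on each fixed vector. -/
theorem isRealVectorBundle [FiniteDimensional ℝ V] (hq : IsOpenQuotientMap q) {ι : Type}
    (c : ι → R.LocalCoord) (hc : ∀ b, ∃ i, b ∈ (c i).domain) :
    IsRealVectorBundle V R.Fiber := by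
  have : CompleteSpace V := FiniteDimensional.complete ℝ V
  choose i hi using hc
  let _ : FiberBundle V R.Fiber :=
    { totalSpaceMk_isInducing' := isInducing_totalSpaceMk
      trivializationAtlas' := range fun i => (c i).trivialization hq
      trivializationAt' := fun b => (c (i b)).trivialization hq
      mem_baseSet_trivializationAt' := hi
      trivialization_mem_atlas' := fun _ => mem_range_self _ }
  refine ⟨inferInstance, ⟨?_, ?_⟩⟩
  · rintro _ ⟨⟨i, rfl⟩⟩
    exact (c i).isLinear_trivialization hq
  · rintro _ _ ⟨⟨i, rfl⟩⟩ ⟨⟨j, rfl⟩⟩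
    have := (c i).isLinear_trivialization hq
    have := (c j).isLinear_trivialization hq
    rw [continuousOn_clm_apply]
    intro v
    have h : ContinuousOn (fun b => (c j).eval ((c i).inv (b, v)))
        ((c i).domain ∩ (c j).domain) :=
      ((c j).continuous_eval.comp_continuousOn ((c i).continuousOn_inv hq)).comp
        (f := fun b => (b, v)) (by fun_prop) fun b hb => ⟨hb.1, mem_univ _⟩
    refine h.congr fun b hb => ?_
    exact Trivialization.coordChangeL_apply' (R := ℝ) ((c i).trivialization hq)
      ((c j).trivialization hq) hb v

/-- Near a given point `f` equals `inv` of its base point and its coordinate. This is the test by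
which all maps into `η` and `ζ'_j` are shown continuous. -/
theorem continuous_of_eval [CompleteSpace V] (hq : IsOpenQuotientMap q) {ι : Type}
    (c : ι → R.LocalCoord) (hc : ∀ b, ∃ i, b ∈ (c i).domain) {T : Type} [TopologicalSpace T]
    {f : T → TotalSpace V R.Fiber} (hf : Continuous fun t => (f t).1)
    (h : ∀ i, Continuous fun t => (c i).eval (f t)) : Continuous f := by
  rw [continuous_iff_continuousAt]
  intro t
  obtain ⟨i, hi⟩ := hc (f t).1
  have h1 : ContinuousAt (c i).inv ((f t).1, (c i).eval (f t)) :=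
    ((c i).continuousOn_inv hq).continuousAt
      (((c i).isOpen_domain.prod isOpen_univ).mem_nhds ⟨hi, mem_univ _⟩)
  refine (h1.comp (f := fun t => ((f t).1, (c i).eval (f t)))
    (hf.prodMk (h i)).continuousAt).congr ?_
  filter_upwards [hf.continuousAt.preimage_mem_nhds ((c i).isOpen_domain.mem_nhds hi)] with s hs
  exact (c i).inv_eval hs

end Identification

/-- If `Φ` is a fibrewise linear bijection of `E₁` onto `E₂`, `E₁` has local frames and `E₂` is
detected by fibrewise injective linear coordinates, then continuity of `Φ` implies that of its
inverse. -/
theorem continuous_symm_of_frames {B F₁ F₂ F W : Type} [TopologicalSpace B]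
    [NormedAddCommGroup F] [NormedSpace ℝ F] [FiniteDimensional ℝ F]
    [NormedAddCommGroup W] [NormedSpace ℝ W] [FiniteDimensional ℝ W]
    {E₁ E₂ : B → Type} [TopologicalSpace (TotalSpace F₁ E₁)] [TopologicalSpace (TotalSpace F₂ E₂)]
    [∀ b, AddCommGroup (E₁ b)] [∀ b, Module ℝ (E₁ b)]
    [∀ b, AddCommGroup (E₂ b)] [∀ b, Module ℝ (E₂ b)]
    (Φ : ∀ b, E₁ b ≃ₗ[ℝ] E₂ b)
    (hΦ : Continuous fun e : TotalSpace F₁ E₁ => (⟨e.1, Φ e.1 e.2⟩ : TotalSpace F₂ E₂))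
    (hproj : Continuous (TotalSpace.proj : TotalSpace F₂ E₂ → B))
    (ψ : ∀ b, E₂ b →ₗ[ℝ] W) (hψi : ∀ b, Function.Injective (ψ b))
    (hψ : Continuous fun e : TotalSpace F₂ E₂ => ψ e.1 e.2)
    (hframe : ∀ b₀, ∃ (f : ∀ b, F →ₗ[ℝ] E₁ b) (U : Set B), IsOpen U ∧ b₀ ∈ U ∧
      (∀ b ∈ U, Function.Bijective (f b)) ∧
      ContinuousOn (fun p : B × F => (⟨p.1, f p.1 p.2⟩ : TotalSpace F₁ E₁)) (U ×ˢ univ)) :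
    Continuous fun e : TotalSpace F₂ E₂ => (⟨e.1, (Φ e.1).symm e.2⟩ : TotalSpace F₁ E₁) := by
  rw [continuous_iff_continuousAt]
  intro e₀
  obtain ⟨f, U, hU, hb₀, hf, hfc⟩ := hframe e₀.1
  set A : B → F →L[ℝ] W := fun b => ((ψ b ∘ₗ (Φ b).toLinearMap) ∘ₗ f b).toContinuousLinearMap
    with hA
  have hAc : ContinuousOn A U := by
    rw [continuousOn_clm_apply]
    intro v
    exact (hψ.comp hΦ).comp_continuousOn (hfc.comp (f := fun b => (b, v)) (by fun_prop)
      fun b hb => ⟨hb, mem_univ _⟩)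
  have hinj : LinearMap.ker (A e₀.1).toLinearMap = ⊥ :=
    LinearMap.ker_eq_bot.2 ((hψi _).comp ((Φ _).injective.comp (hf _ hb₀).1))
  -- `A b` is the injective map `ψ ∘ Φ` written in the frame. With `g` a left inverse at the single
  -- point `e₀.1`, `L b = g ∘ A b` is the identity there, hence invertible nearby, and `Φ⁻¹ = f ∘
  -- L⁻¹ ∘ g ∘ ψ` near `e₀`.
  obtain ⟨g, hg⟩ := (A e₀.1).toLinearMap.exists_leftInverse_of_injective hinj
  set L : B → F →L[ℝ] F := fun b => g.toContinuousLinearMap.comp (A b) with hL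
  have hLc : ContinuousOn L U := continuousOn_const.clm_comp hAc
  have hL0 : L e₀.1 = ContinuousLinearEquiv.refl ℝ F := by
    ext v
    exact LinearMap.congr_fun hg v
  have hinvc : ContinuousAt (fun b => (L b).inverse) e₀.1 := by
    refine ContinuousAt.comp (g := ContinuousLinearMap.inverse) (f := L) ?_
      (hLc.continuousAt (hU.mem_nhds hb₀))
    rw [hL0]
    exact (contDiffAt_map_inverse (n := 0) (ContinuousLinearEquiv.refl ℝ F)).continuousAt
  have hev : ∀ᶠ b in 𝓝 e₀.1, (L b).IsInvertible := by
    have h1 := (hLc.continuousAt (hU.mem_nhds hb₀)).preimage_mem_nhds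
      (hL0 ▸ (ContinuousLinearEquiv.refl ℝ F).nhds)
    filter_upwards [h1] with b hb
    obtain ⟨E, hE⟩ := hb
    exact ⟨E, hE⟩
  have key : ContinuousAt (fun e : TotalSpace F₂ E₂ =>
      (⟨e.1, f e.1 ((L e.1).inverse (g (ψ e.1 e.2)))⟩ : TotalSpace F₁ E₁)) e₀ := by
    have h1 : ContinuousAt (fun e : TotalSpace F₂ E₂ =>
        (e.1, (L e.1).inverse (g.toContinuousLinearMap (ψ e.1 e.2)))) e₀ := by
      refine hproj.continuousAt.prodMk (ContinuousAt.clm_apply ?_ ?_)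
      · exact ContinuousAt.comp (g := fun b => (L b).inverse) hinvc hproj.continuousAt
      · exact (g.toContinuousLinearMap.continuous.comp hψ).continuousAt
    exact (hfc.continuousAt ((hU.prod isOpen_univ).mem_nhds ⟨hb₀, mem_univ _⟩)).comp h1
  refine key.congr ?_
  filter_upwards [hproj.continuousAt.preimage_mem_nhds (hU.mem_nhds hb₀),
    hproj.continuousAt.eventually hev] with e he hLe
  -- With `v` the frame coordinates of `Φ⁻¹ e`, one has `g (ψ e) = L v`, so applying `L⁻¹` recovers
  -- `v`.
  obtain ⟨v, hv⟩ := (hf _ he).2 ((Φ e.1).symm e.2)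
  refine congrArg (TotalSpace.mk e.1) ?_
  have h1 : g (ψ e.1 e.2) = L e.1 v := by
    change _ = g (ψ e.1 (Φ e.1 (f e.1 v)))
    rw [hv, LinearEquiv.apply_symm_apply]
  rw [h1, hLe.inverse_apply_eq.2 rfl, hv]

/-! ### Projection matrices as functions on complex projective space. -/

namespace CP

variable {n : ℕ}

/-- The entry `v s * conj (v t) / ‖v‖²` of the orthogonal projection onto the line `[v]`. -/
def herm (s t : Fin (n + 1)) (p : CP n) : ℂ :=
  Quotient.lift
    (fun v : Vec n => v.1 s * conj (v.1 t) / ((∑ i, Complex.normSq (v.1 i) : ℝ) : ℂ)) (by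
    intro v w h
    obtain ⟨a, ha⟩ := mk_eq_iff.1 (Quotient.sound h : mk v = mk w)
    have ha0 : ((Complex.normSq a : ℝ) : ℂ) ≠ 0 :=
      Complex.ofReal_ne_zero.2 (Complex.normSq_pos.2 (scalar_ne_zero ha)).ne'
    simp only [← ha, map_mul, ← Finset.mul_sum, Complex.ofReal_mul]
    rw [eq_comm, ← mul_div_mul_left _ _ ha0, Complex.normSq_eq_conj_mul_self]
    congr 1
    ring1) p

theorem herm_mk (s t : Fin (n + 1)) (v : Vec n) :
    herm s t (mk v) = v.1 s * conj (v.1 t) / ((∑ i, Complex.normSq (v.1 i) : ℝ) : ℂ) := rfl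

theorem sum_normSq (u : Metric.sphere (0 : EuclideanSpace ℂ (Fin (n + 1))) 1) :
    ∑ i, Complex.normSq (u.1 i) = 1 := by
  have h := norm_eq_of_mem_sphere u
  rw [EuclideanSpace.norm_eq, Real.sqrt_eq_one] at h
  simpa only [Complex.normSq_eq_norm_sq] using h

theorem herm_ofSphere (s t : Fin (n + 1))
    (u : Metric.sphere (0 : EuclideanSpace ℂ (Fin (n + 1))) 1) :
    herm s t (ofSphere u) = u.1 s * conj (u.1 t) := by
  rw [ofSphere, herm_mk, sum_normSq u, Complex.ofReal_one, div_one]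

theorem herm_conj (s t : Fin (n + 1)) (p : CP n) : herm s t p.conj = conj (herm s t p) := by
  obtain ⟨u, rfl⟩ := ofSphere_surjective p
  rw [conj_ofSphere, herm_ofSphere, herm_ofSphere, map_mul]
  rfl

theorem conj_herm (s t : Fin (n + 1)) (p : CP n) : conj (herm s t p) = herm t s p := by
  obtain ⟨u, rfl⟩ := ofSphere_surjective p
  rw [herm_ofSphere, herm_ofSphere, map_mul, Complex.conj_conj, mul_comm]

/-- Idempotence `P² = P` of the projection, from `uᴴ u = 1`. Together with `conj_herm` it is what
gets differentiated later. -/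
theorem sum_herm_mul_herm (s r : Fin (n + 1)) (p : CP n) :
    ∑ t, herm s t p * herm t r p = herm s r p := by
  obtain ⟨u, rfl⟩ := ofSphere_surjective p
  have h : ((∑ i, Complex.normSq (u.1 i) : ℝ) : ℂ) = 1 := by rw [sum_normSq, Complex.ofReal_one]
  simp only [herm_ofSphere]
  rw [← mul_one (u.1 s * conj (u.1 r)), ← h, Complex.ofReal_sum, Finset.mul_sum]
  refine Finset.sum_congr rfl fun t _ => ?_
  rw [Complex.normSq_eq_conj_mul_self]
  ring

theorem contDiff_herm_affine (i s t : Fin (n + 1)) :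
    ContDiff ℝ ∞ fun w : Fin n → ℂ => herm s t (mk (affineVec i w)) := by
  simp only [herm_mk, div_eq_mul_inv]
  refine ((contDiff_affineVec i s).mul
    (Complex.conjCLE.contDiff.comp (contDiff_affineVec i t))).mul ?_
  simp only [← Complex.ofReal_inv]
  refine Complex.ofRealCLM.contDiff.comp (ContDiff.inv (ContDiff.sum fun j _ => ?_) fun w => ?_)
  · simp only [Complex.normSq_apply]
    have h1 := Complex.reCLM.contDiff.comp (contDiff_affineVec i j)
    have h2 := Complex.imCLM.contDiff.comp (contDiff_affineVec i j)
    exact (h1.mul h1).add (h2.mul h2)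
  · refine (Finset.sum_pos' (fun j _ => Complex.normSq_nonneg _) ⟨i, Finset.mem_univ _, ?_⟩).ne'
    rw [affineVec_same]
    exact Complex.normSq_pos.2 one_ne_zero

theorem continuous_herm (s t : Fin (n + 1)) : Continuous (herm (n := n) s t) := by
  refine Continuous.quotient_lift ?_ _
  refine Continuous.div ?_ ?_ ?_
  · have h : ∀ s, Continuous fun v : Vec n => v.1 s := fun s => by fun_prop
    exact (h s).mul (Complex.continuous_conj.comp (h t))
  · refine Complex.continuous_ofReal.comp (continuous_finsetSum _ fun j _ => ?_)
    exact Complex.continuous_normSq.comp (by fun_prop)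
  · intro v
    obtain ⟨i, hi⟩ := exists_coord v
    exact Complex.ofReal_ne_zero.2 (Finset.sum_pos' (fun j _ => Complex.normSq_nonneg _)
      ⟨i, Finset.mem_univ _, Complex.normSq_pos.2 hi⟩).ne'

theorem chartAt_symm (p : CP n) : ∃ i, p ∈ affineDomain i ∧
    ((chartAt (Fin n → ℂ) p).symm : (Fin n → ℂ) → CP n) = (fun w => mk (affineVec i w)) :=
  ⟨_, (exists_mem_affineDomain p).choose_spec, rfl⟩

/-- Openness comes from normalization `N v = v / ‖v‖`: it does not change the line, so the image of
`U` is the image under the open map `mk` of the open set `N⁻¹ U`. -/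
theorem isOpenQuotientMap_ofSphere : IsOpenQuotientMap (ofSphere (n := n)) := by
  have hc : Continuous fun u : Metric.sphere (0 : EuclideanSpace ℂ (Fin (n + 1))) 1 =>
      (⟨u.1, ne_zero_of_mem_unit_sphere u⟩ : Vec n) :=
    Continuous.subtype_mk continuous_subtype_val fun u => ne_zero_of_mem_unit_sphere u
  refine ⟨ofSphere_surjective, continuous_mk.comp hc, fun U hU => ?_⟩
  have hN : ∀ v : Vec n, ((‖v.1‖ : ℂ)⁻¹) • v.1 ∈
      Metric.sphere (0 : EuclideanSpace ℂ (Fin (n + 1))) 1 := fun v => by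
    rw [mem_sphere_zero_iff_norm, norm_smul, norm_inv, Complex.norm_real, norm_norm,
      inv_mul_cancel₀ (norm_ne_zero_iff.2 v.2)]
  let N : Vec n → Metric.sphere (0 : EuclideanSpace ℂ (Fin (n + 1))) 1 := fun v => ⟨_, hN v⟩
  have hNc : Continuous N := by
    have h : Continuous fun v : Vec n => (‖v.1‖ : ℂ) :=
      Complex.continuous_ofReal.comp (continuous_norm.comp continuous_subtype_val)
    exact ((h.inv₀ fun v => Complex.ofReal_ne_zero.2 (norm_ne_zero_iff.2 v.2)).smul
      continuous_subtype_val).subtype_mk hN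
  have hmk : ∀ v, ofSphere (N v) = mk v := fun v =>
    mk_eq_iff.2 ⟨(‖v.1‖ : ℂ)⁻¹, fun i => rfl⟩
  have e : ofSphere '' U = mk '' (N ⁻¹' U) := by
    ext p
    constructor
    · rintro ⟨u, hu, rfl⟩
      refine ⟨⟨u.1, ne_zero_of_mem_unit_sphere u⟩, ?_, rfl⟩
      have : N ⟨u.1, ne_zero_of_mem_unit_sphere u⟩ = u := Subtype.ext (by
        simp only [N, norm_eq_of_mem_sphere, Complex.ofReal_one, inv_one, one_smul])
      rwa [mem_preimage, this]
    · rintro ⟨v, hv, rfl⟩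
      exact ⟨N v, hv, hmk v⟩
  rw [e]
  exact isOpenQuotientMap_mk.isOpenMap _ (hU.preimage hNc)

end CP

/-- Stereographic charts have the whole model space as target, so their inverses are smooth
everywhere. The affine charts share this property, and derivatives in charts can therefore be plain
`fderiv`s. -/
theorem contDiff_coe_chartAt_symm {d : ℕ}
    (x : Metric.sphere (0 : EuclideanSpace ℝ (Fin (d + 1))) 1) :
    ContDiff ℝ ∞ fun w => ((chartAt (EuclideanSpace ℝ (Fin d)) x).symm w).1 := by
  have := Fact.mk (@finrank_euclideanSpace_fin ℝ _ (d + 1))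
  have h := (contMDiff_iff.1 (contMDiff_coe_sphere (m := ∞) (n := d)
    (E := EuclideanSpace ℝ (Fin (d + 1))))).2 x 0
  rw [← contDiffOn_univ]
  refine (h.mono fun w _ => ?_).congr fun w _ => rfl
  have ht : (chartAt (EuclideanSpace ℝ (Fin d)) x).target = univ := stereographic'_target _
  simp only [ht, chartAt_self_eq, mfld_simps]

/-! ### Functions on the double cover and their derivatives in the charts of `P_T`. -/

section Cover

variable {k l : ℕ} {m : Fin k → ℕ} {n : Fin l → ℕ}

theorem PT.isOpenQuotientMap_mk : IsOpenQuotientMap (PT.mk : Cover m n → PT m n) :=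
  MulAction.isOpenQuotientMap_quotientMk

theorem isOpenQuotientMap_hopf : IsOpenQuotientMap (hopf m n) :=
  PT.isOpenQuotientMap_mk.comp (f := fun a : SphereProd m × OddSphereProd n =>
    ((a.1, fun j => CP.ofSphere (a.2 j)) : Cover m n))
    (IsOpenQuotientMap.id.prodMap (IsOpenQuotientMap.piMap fun _ => CP.isOpenQuotientMap_ofSphere))

namespace Cover

/-- The inverse of the preferred chart at `q`. -/
def param (q : Cover m n) : ModelE m n → Cover m n := (chartAt (ModelE m n) q).symm

/-- The chart coordinates of `q` in the preferred chart at `q`. -/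
def center (q : Cover m n) : ModelE m n := chartAt (ModelE m n) q q

theorem param_center (q : Cover m n) : param q (center q) = q :=
  (chartAt (ModelE m n) q).left_inv (mem_chart_source _ q)

/-- The sphere coordinates. -/
def coord (a : Σ i, Fin (m i + 1)) (q : Cover m n) : ℝ := (q.1 a.1).1 a.2

/-- The entries of the projection matrix of a point of a projective factor. -/
def herm (j : Fin l) (s t : Fin (n j + 1)) (q : Cover m n) : ℂ := (q.2 j).herm s t

/-- Continuous functions which are smooth in every preferred chart. -/
def Smooth {F : Type} [NormedAddCommGroup F] [NormedSpace ℝ F] (g : Cover m n → F) : Prop :=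
  Continuous g ∧ ∀ q, ContDiff ℝ ∞ (g ∘ param q)

theorem smooth_coord (a : Σ i, Fin (m i + 1)) : Smooth (coord a : Cover m n → ℝ) := by
  constructor
  · have h : Continuous fun q : Cover m n => q.1 a.1 :=
      (continuous_apply a.1).comp continuous_fst
    exact (EuclideanSpace.proj a.2 : EuclideanSpace ℝ (Fin (m a.1 + 1)) →L[ℝ] ℝ).continuous.comp
      (continuous_subtype_val.comp h)
  · intro q
    exact ((EuclideanSpace.proj a.2 : EuclideanSpace ℝ (Fin (m a.1 + 1)) →L[ℝ] ℝ).contDiff.comp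
      (contDiff_coe_chartAt_symm (q.1 a.1))).comp ((ContinuousLinearMap.proj (R := ℝ)
        (φ := fun i => EuclideanSpace ℝ (Fin (m i))) a.1).contDiff.comp contDiff_fst)

theorem smooth_herm (j : Fin l) (s t : Fin (n j + 1)) :
    Smooth (herm j s t : Cover m n → ℂ) := by
  constructor
  · have h : Continuous fun q : Cover m n => q.2 j := (continuous_apply j).comp continuous_snd
    exact (CP.continuous_herm s t).comp h
  · intro q
    obtain ⟨i, -, hi⟩ := CP.chartAt_symm (q.2 j)
    have h : (herm j s t ∘ param q : ModelE m n → ℂ) =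
        (fun w => CP.herm s t (CP.mk (CP.affineVec i w))) ∘ fun e : ModelE m n => e.2 j := by
      funext e
      change CP.herm s t ((chartAt (Fin (n j) → ℂ) (q.2 j)).symm (e.2 j)) = _
      rw [hi]
      rfl
    rw [h]
    exact (CP.contDiff_herm_affine i s t).comp ((ContinuousLinearMap.proj (R := ℝ)
      (φ := fun j => Fin (n j) → ℂ) j).contDiff.comp contDiff_snd)

/-- The derivative of a function in the preferred chart at `q`. -/
def deriv {F : Type} [NormedAddCommGroup F] [NormedSpace ℝ F] (q : Cover m n) (g : Cover m n → F) :
    ModelE m n →L[ℝ] F := fderiv ℝ (g ∘ param q) (center q)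

end Cover

namespace PT

variable [NeZero k]

/-- The preferred chart of `P_T` at `p` is a local section of the covering followed by the preferred
chart at one preimage of `p`. Singling out that preimage lets a tangent vector at `p`, as an element
of `ModelE m n`, be read in a chart of the cover. -/
theorem exists_lift (p : PT m n) : ∃ q : Cover m n, mk q = p ∧
    ((chartAt (ModelE m n) p).symm : ModelE m n → PT m n) = mk ∘ q.param ∧
    chartAt (ModelE m n) p p = q.center := by
  have hq : IsLocalHomeomorph
      (Quotient.mk _ : Cover m n → MulAction.orbitRel.Quotient ℤˣ (Cover m n)) :=
    (isQuotientCoveringMap_quotientMk_of_properlyDiscontinuousSMul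
      (G := ℤˣ) (E := Cover m n)).isCoveringMap.isLocalHomeomorph
  have hs : Function.Surjective
      (Quotient.mk _ : Cover m n → MulAction.orbitRel.Quotient ℤˣ (Cover m n)) :=
    Quotient.mk_surjective
  -- The preimage must be the one used in the charted space structure of the quotient, so that the
  -- charts below unfold to the stated form.
  have hg := hs.hasRightInverse.choose_spec
  set g := hs.hasRightInverse.choose
  refine ⟨g p, hg p, ?_, ?_⟩
  · change ((hq.localInverseAt (x := g p)).symm ∘ (chartAt (ModelE m n) (g p)).symm) = _
    rw [IsLocalHomeomorph.localInverseAt_symm]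
    rfl
  · change chartAt (ModelE m n) (g p) (hq.localInverseAt (x := g p) p) = _
    have : hq.localInverseAt (x := g p) p = g p := by
      have h := hq.localInverseAt_apply_self (x := g p)
      rwa [hg p] at h
    rw [this]
    rfl

/-- The point of the double cover whose chart induces the preferred chart of `P_T` at `p`. -/
def lift (p : PT m n) : Cover m n := (exists_lift p).choose

@[simp] theorem mk_lift (p : PT m n) : mk (lift p) = p := (exists_lift p).choose_spec.1

theorem chartAt_symm (p : PT m n) :
    ((chartAt (ModelE m n) p).symm : ModelE m n → PT m n) = mk ∘ (lift p).param :=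
  (exists_lift p).choose_spec.2.1

theorem chartAt_self (p : PT m n) : chartAt (ModelE m n) p p = (lift p).center :=
  (exists_lift p).choose_spec.2.2

variable {g : Cover m n → ℝ}

theorem contMDiff_of_smooth {f : PT m n → ℝ} (hf : f ∘ mk = g) (hg : Cover.Smooth g) :
    ContMDiff 𝓘(ℝ, ModelE m n) 𝓘(ℝ, ℝ) ∞ f := by
  rw [contMDiff_iff]
  refine ⟨isOpenQuotientMap_mk.continuous_comp_iff.1 (hf ▸ hg.1), fun x y => ?_⟩
  refine (((hg.2 (lift x)).contDiffOn
    (s := (extChartAt 𝓘(ℝ, ModelE m n) x).target)).mono ?_).congr ?_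
  · exact inter_subset_left
  · intro e _
    simp only [mfld_simps, chartAt_self_eq, chartAt_symm, ← hf]

theorem mfderiv_eq {f : PT m n → ℝ} (hf : f ∘ mk = g) (hg : Cover.Smooth g) (p : PT m n)
    (v : ModelE m n) :
    mfderiv 𝓘(ℝ, ModelE m n) 𝓘(ℝ, ℝ) f p v = (lift p).deriv g v := by
  have h := (contMDiff_of_smooth hf hg).mdifferentiableAt (x := p) (by simp)
  rw [h.mfderiv]
  simp only [mfld_simps, fderivWithin_univ, chartAt_symm, chartAt_self, Cover.deriv, ← hf]
  rfl

/-- The expression is the fibre component of the tangent map of `f`, which is continuous because `f`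
is smooth. The topology of the tangent bundle enters on the source side only through this. -/
theorem continuous_deriv {f : PT m n → ℝ} (hf : f ∘ mk = g) (hg : Cover.Smooth g) :
    Continuous fun e : TangentBundle 𝓘(ℝ, ModelE m n) (PT m n) => (lift e.1).deriv g e.2 := by
  have h := (contMDiff_of_smooth hf hg).continuous_tangentMap (by simp)
  have h2 : Continuous fun e : TangentBundle 𝓘(ℝ, ℝ) ℝ => (e.2 : ℝ) :=
    continuous_snd.comp (tangentBundleModelSpaceHomeomorph 𝓘(ℝ, ℝ)).continuous
  refine (h2.comp h).congr fun e => ?_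
  exact mfderiv_eq hf hg e.1 e.2

end PT

end Cover

/-! ### Tangent vectors are determined by the variations of coordinates and projections. -/

open Matrix in
/-- If the first-order variation `d` of a rank one projection `u uᴴ` satisfies `d u = -c u`, then
`c = 0` and `d = 0`. -/
theorem eq_zero_of_projection_variation {ι : Type} [Fintype ι] (u : ι → ℂ) (hu : star u ⬝ᵥ u = 1)
    (d : Matrix ι ι ℂ) (hd : vecMulVec u (star u) * d + d * vecMulVec u (star u) = d)
    (hs : dᴴ = d) (c : ℂ) (h : d *ᵥ u + c • u = 0) : c = 0 ∧ d = 0 := by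
  have hu0 : vecMulVec u (star u) *ᵥ u = u := by
    rw [vecMulVec_mulVec, hu]
    simp
  have hdu : d *ᵥ u = -(c • u) := eq_neg_of_add_eq_zero_left h
  -- Applying `P d + d P = d` to `u = P u` gives `P d u = 0`: the variation moves `u` orthogonally
  -- to itself, while `d u = -c u` is parallel to `u`.
  have h1 : vecMulVec u (star u) *ᵥ (d *ᵥ u) + d *ᵥ u = d *ᵥ u := by
    conv_rhs => rw [← hd]
    rw [add_mulVec, ← mulVec_mulVec, ← mulVec_mulVec, hu0]
  have h2 : c • u = 0 := by
    have h3 := add_eq_right.1 h1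
    rwa [hdu, mulVec_neg, mulVec_smul, hu0, neg_eq_zero] at h3
  have hc : c = 0 := by
    have h3 := congrArg (star u ⬝ᵥ ·) h2
    simpa [hu] using h3
  have h4 : d *ᵥ u = 0 := by rw [hdu, h2, neg_zero]
  have h5 : d * vecMulVec u (star u) = 0 := by
    rw [mul_vecMulVec, h4]
    simp
  -- The adjoint of `d P = 0`, as `d` and `P` are Hermitian; then `d = P d + d P` vanishes.
  have h6 : vecMulVec u (star u) * d = 0 := by
    have h7 := congrArg conjTranspose h5
    rwa [conjTranspose_mul, hs, conjTranspose_vecMulVec, star_star, conjTranspose_zero] at h7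
  exact ⟨hc, by rw [← hd, h5, h6, add_zero]⟩

theorem eq_zero_of_fderiv_sphere {d : ℕ}
    (x : Metric.sphere (0 : EuclideanSpace ℝ (Fin (d + 1))) 1) (v : EuclideanSpace ℝ (Fin d))
    (h : fderiv ℝ (fun w => ((chartAt (EuclideanSpace ℝ (Fin d)) x).symm w).1)
      (chartAt (EuclideanSpace ℝ (Fin d)) x x) v = 0) : v = 0 := by
  have := Fact.mk (@finrank_euclideanSpace_fin ℝ _ (d + 1))
  have hi := injective_mvfderiv_subtypeVal_sphere (n := d) x
  rw [((contMDiff_coe_sphere x).mdifferentiableAt one_ne_zero).mvfderiv] at hi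
  simp only [fderivWithin_univ, mfld_simps] at hi
  exact hi (h.trans (map_zero _).symm)

/-- In the affine chart `i`, the entry of `P` at `(i.succAbove r, i)` is `w r` times the entry at
`(i, i)`. When the derivatives of both entries vanish, the product rule leaves `v r` times the
diagonal entry, which is nonzero. -/
theorem CP.eq_zero_of_fderiv_herm {d : ℕ} (p : CP d) (v : Fin d → ℂ)
    (h : ∀ s t, fderiv ℝ (fun w => CP.herm s t ((chartAt (Fin d → ℂ) p).symm w))
      (chartAt (Fin d → ℂ) p p) v = 0) : v = 0 := by
  obtain ⟨i, -, hi⟩ := CP.chartAt_symm p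
  rw [hi] at h
  set w₀ := chartAt (Fin d → ℂ) p p
  have hd : ∀ s t, DifferentiableAt ℝ (fun w => CP.herm s t (CP.mk (CP.affineVec i w))) w₀ :=
    fun s t => ((CP.contDiff_herm_affine i s t).differentiable (by simp)).differentiableAt
  funext r
  have hne : CP.herm i i (CP.mk (CP.affineVec i w₀)) ≠ 0 := by
    rw [CP.herm_mk, CP.affineVec_same, map_one, mul_one]
    refine one_div_ne_zero (Complex.ofReal_ne_zero.2 (Finset.sum_pos'
      (fun j _ => Complex.normSq_nonneg _) ⟨i, Finset.mem_univ _, ?_⟩).ne')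
    rw [CP.affineVec_same]
    exact Complex.normSq_pos.2 one_ne_zero
  have e : (fun w : Fin d → ℂ => CP.herm (i.succAbove r) i (CP.mk (CP.affineVec i w))) =
      fun w => w r * CP.herm i i (CP.mk (CP.affineVec i w)) := by
    funext w
    rw [CP.herm_mk, CP.herm_mk, CP.affineVec_same, CP.affineVec_succAbove]
    ring
  have h1 := h (i.succAbove r) i
  rw [e, fderiv_fun_mul (by fun_prop) (hd i i)] at h1
  have h2 := h i i
  have h3 : fderiv ℝ (fun w : Fin d → ℂ => w r) w₀ v = v r := by
    rw [(hasFDerivAt_apply r w₀).fderiv]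
    rfl
  simp only [add_apply, smul_apply, h2, h3, smul_eq_mul, mul_zero, zero_add] at h1
  exact (mul_eq_zero.1 h1).resolve_left hne

namespace Cover

variable {k l : ℕ} {m : Fin k → ℕ} {n : Fin l → ℕ}

section deriv

variable {F G : Type} [NormedAddCommGroup F] [NormedSpace ℝ F] [NormedAddCommGroup G]
  [NormedSpace ℝ G] {𝔸 : Type} [NormedCommRing 𝔸] [NormedAlgebra ℝ 𝔸]

theorem Smooth.differentiableAt {g : Cover m n → F} (hg : Smooth g) (q : Cover m n) :
    DifferentiableAt ℝ (g ∘ param q) (center q) :=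
  ((hg.2 q).differentiable (by simp)).differentiableAt

theorem Smooth.clm_comp (L : F →L[ℝ] G) {g : Cover m n → F} (hg : Smooth g) :
    Smooth fun q => L (g q) :=
  ⟨L.continuous.comp hg.1, fun q => L.contDiff.comp (hg.2 q)⟩

theorem Smooth.mul {g h : Cover m n → 𝔸} (hg : Smooth g) (hh : Smooth h) :
    Smooth fun q => g q * h q := ⟨hg.1.mul hh.1, fun q => (hg.2 q).mul (hh.2 q)⟩

theorem deriv_clm_comp (L : F →L[ℝ] G) {g : Cover m n → F} (hg : Smooth g) (q : Cover m n)
    (v : ModelE m n) : deriv q (fun x => L (g x)) v = L (deriv q g v) := by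
  have h := (L.hasFDerivAt.comp (center q) (hg.differentiableAt q).hasFDerivAt).fderiv
  exact DFunLike.congr_fun h v

theorem deriv_mul {g h : Cover m n → 𝔸} (hg : Smooth g) (hh : Smooth h) (q : Cover m n)
    (v : ModelE m n) :
    deriv q (fun x => g x * h x) v = g q * deriv q h v + deriv q g v * h q := by
  have e := fderiv_fun_mul (hg.differentiableAt q) (hh.differentiableAt q)
  have e' := DFunLike.congr_fun e v
  simp only [Function.comp_apply, param_center, add_apply,
    smul_apply, smul_eq_mul] at e'
  rw [mul_comm (deriv q g v)]
  exact e'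

theorem deriv_sum {ι : Type} [Fintype ι] {g : ι → Cover m n → F} (hg : ∀ i, Smooth (g i))
    (q : Cover m n) (v : ModelE m n) :
    deriv q (fun x => ∑ i, g i x) v = ∑ i, deriv q (g i) v := by
  have e := fderiv_fun_sum (u := Finset.univ) fun i _ => (hg i).differentiableAt q
  have e' := DFunLike.congr_fun e v
  rw [sum_apply] at e'
  exact e'

theorem deriv_const (c : F) (q : Cover m n) (v : ModelE m n) :
    deriv q (fun _ => c) v = 0 := by
  have e : ((fun _ => c : Cover m n → F) ∘ param q) = fun _ => c := rfl
  rw [deriv, e, fderiv_fun_const]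
  rfl

end deriv

theorem sum_coord_mul_coord (i : Fin k) (q : Cover m n) :
    ∑ s, coord ⟨i, s⟩ q * coord ⟨i, s⟩ q = 1 := by
  have h := norm_eq_of_mem_sphere (q.1 i)
  rw [EuclideanSpace.norm_eq, Real.sqrt_eq_one] at h
  simp only [Real.norm_eq_abs, pow_two] at h
  simp only [abs_mul_abs_self] at h
  exact h

/-- Differentiation of `|x|² = 1`: tangent vectors are orthogonal to `x`. -/
theorem sum_coord_mul_deriv (i : Fin k) (q : Cover m n) (v : ModelE m n) :
    ∑ s, coord ⟨i, s⟩ q * deriv q (coord ⟨i, s⟩) v = 0 := by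
  have h := deriv_sum (fun s => (smooth_coord (n := n) ⟨i, s⟩).mul (smooth_coord ⟨i, s⟩)) q v
  simp only [sum_coord_mul_coord, deriv_const, deriv_mul (smooth_coord _) (smooth_coord _),
    mul_comm (deriv q _ v), ← two_mul, ← Finset.mul_sum] at h
  linarith

theorem exists_coord_ne_zero (i : Fin k) (q : Cover m n) : ∃ s, coord ⟨i, s⟩ q ≠ 0 := by
  by_contra! h
  have h1 := sum_coord_mul_coord i q
  simp [h] at h1

theorem coord_invol (a : Σ i, Fin (m i + 1)) (q : Cover m n) :
    coord a q.invol = -coord a q := rfl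

theorem herm_invol (j : Fin l) (s t : Fin (n j + 1)) (q : Cover m n) :
    herm j s t q.invol = conj (herm j s t q) := CP.herm_conj s t (q.2 j)

theorem eq_zero_of_deriv_coord {i : Fin k} {q : Cover m n} {v : ModelE m n}
    (h : ∀ s, deriv q (coord ⟨i, s⟩) v = 0) : v.1 i = 0 := by
  have := Fact.mk (@finrank_euclideanSpace_fin ℝ _ (m i + 1))
  refine eq_zero_of_fderiv_sphere (q.1 i) (v.1 i) ?_
  set g := fun w : EuclideanSpace ℝ (Fin (m i)) =>
    ((chartAt (EuclideanSpace ℝ (Fin (m i))) (q.1 i)).symm w).1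
  have hg : Differentiable ℝ g := (contDiff_coe_chartAt_symm (q.1 i)).differentiable (by simp)
  let P : ModelE m n →L[ℝ] EuclideanSpace ℝ (Fin (m i)) :=
    (ContinuousLinearMap.proj (R := ℝ) (φ := fun i => EuclideanSpace ℝ (Fin (m i))) i).comp
      (ContinuousLinearMap.fst ℝ _ _)
  ext s
  rw [PiLp.zero_apply, ← h s]
  have h1 := ((EuclideanSpace.proj s : EuclideanSpace ℝ (Fin (m i + 1)) →L[ℝ] ℝ).hasFDerivAt.comp
    (center q) ((hg _).hasFDerivAt.comp (center q) P.hasFDerivAt)).fderiv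
  exact (DFunLike.congr_fun h1 v).symm

theorem eq_zero_of_deriv_herm {j : Fin l} {q : Cover m n} {v : ModelE m n}
    (h : ∀ s t, deriv q (herm j s t) v = 0) : v.2 j = 0 := by
  refine CP.eq_zero_of_fderiv_herm (q.2 j) (v.2 j) fun s t => ?_
  rw [← h s t]
  set g := fun w : Fin (n j) → ℂ => CP.herm s t ((chartAt (Fin (n j) → ℂ) (q.2 j)).symm w)
  have hg : Differentiable ℝ g := by
    obtain ⟨i, -, hi⟩ := CP.chartAt_symm (q.2 j)
    simp only [g, hi]
    exact (CP.contDiff_herm_affine i s t).differentiable (by simp)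
  let P : ModelE m n →L[ℝ] (Fin (n j) → ℂ) :=
    (ContinuousLinearMap.proj (R := ℝ) (φ := fun j => Fin (n j) → ℂ) j).comp
      (ContinuousLinearMap.snd ℝ _ _)
  have h1 := ((hg _).hasFDerivAt.comp (center q) P.hasFDerivAt).fderiv
  exact (DFunLike.congr_fun h1 v).symm

theorem conj_deriv_herm (j : Fin l) (s t : Fin (n j + 1)) (q : Cover m n) (v : ModelE m n) :
    conj (deriv q (herm j s t) v) = deriv q (herm j t s) v := by
  have h := deriv_clm_comp (Complex.conjCLE : ℂ →L[ℝ] ℂ) (smooth_herm (m := m) j s t) q v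
  refine h.symm.trans ?_
  congr 2
  funext x
  exact CP.conj_herm s t (x.2 j)

/-- The derivative of `P² = P`, in the form required by `eq_zero_of_projection_variation`;
`conj_deriv_herm` gives the Hermitian hypothesis. -/
theorem deriv_herm_eq (j : Fin l) (s r : Fin (n j + 1)) (q : Cover m n) (v : ModelE m n) :
    ∑ t, (herm j s t q * deriv q (herm j t r) v + deriv q (herm j s t) v * herm j t r q) =
      deriv q (herm j s r) v := by
  have h := deriv_sum (fun t => (smooth_herm (m := m) j s t).mul (smooth_herm j t r)) q v
  simp only [deriv_mul (smooth_herm j s _) (smooth_herm j _ r)] at h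
  refine h.symm.trans ?_
  congr 2
  funext x
  exact CP.sum_herm_mul_herm s r (x.2 j)

end Cover

/-! ### Local coordinates from compatible families of linear maps. -/

namespace Identification.LocalCoord

variable {Y B V : Type} [TopologicalSpace Y] [TopologicalSpace B] [NormedAddCommGroup V]
  [NormedSpace ℝ V] [CompleteSpace V] {q : Y → B} {R : Identification q V}

/-- The local coordinate given by a continuous family of linear maps compatible with the
identification. -/
def ofCompat (hq : IsOpenQuotientMap q) (φ : Y → V →L[ℝ] V) (hφ : Continuous φ)
    (h : ∀ {a b : Y × V}, R.rel a b → φ a.1 a.2 = φ b.1 b.2) : R.LocalCoord where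
  toFun := φ
  continuous_toFun := hφ
  compat := h
  domain := q '' {y | (φ y).IsInvertible}
  isOpen_domain := by
    refine hq.isOpenMap _ ?_
    exact (ContinuousLinearEquiv.isOpen (𝕜 := ℝ) (E := V) (F := V)).preimage hφ
  isInvertible := by
    rintro y ⟨y', hy', e⟩
    -- Compatibility gives `φ y = φ y' ∘ A`, so invertibility at one point of a fibre of `q` spreads
    -- to the whole fibre.
    obtain ⟨A, hA⟩ := R.linear y y' e.symm
    have h1 : ∀ v, φ y v = φ y' (A v) := fun v => h ((hA v (A v)).2 rfl)
    obtain ⟨E, hE⟩ := hy'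
    have hb : Function.Bijective (φ y) := by
      have h2 : (φ y : V → V) = E ∘ A := by
        funext v
        rw [h1, ← hE]
        rfl
      rw [h2]
      exact E.bijective.comp A.bijective
    exact ⟨ContinuousLinearEquiv.ofBijective (φ y) (LinearMap.ker_eq_bot.2 hb.1)
      (LinearMap.range_eq_top.2 hb.2), ContinuousLinearEquiv.coe_ofBijective _ _ _⟩

end Identification.LocalCoord

section OddFunctions

variable {k l : ℕ} [NeZero k] {m : Fin k → ℕ} {n : Fin l → ℕ}

/-! ### Even and odd functions under the involution. -/

section Parity

open Cover

variable {T : Type} [TopologicalSpace T]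

/-- `lift` may jump between the two sheets, but an even function takes the same value on both and
descends to the quotient. -/
theorem continuous_of_even {g : Cover m n → ℝ} (hg : Continuous g) (he : ∀ q, g q.invol = g q)
    {ρ : T → PT m n} (hρ : Continuous ρ) : Continuous fun t => g (ρ t).lift := by
  have hf : Continuous fun p : PT m n => g p.lift := by
    rw [← PT.isOpenQuotientMap_mk.continuous_comp_iff]
    refine hg.congr fun q => ?_
    rcases PT.mk_eq_iff.1 (PT.mk_lift (PT.mk q)) with h | h
    · exact congrArg g h.symm
    · exact (he q).symm.trans (congrArg g h.symm)
  exact hf.comp hρ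

/-- A real function, computed with a representative `β t` in the double cover, which becomes
continuous after multiplication with each of the coordinates of the first sphere. These coordinates
change sign when the representative is changed. -/
def OddContinuous (β : T → Cover m n) (f : T → ℝ) : Prop :=
  ∀ s, Continuous fun t => coord ⟨0, s⟩ (β t) * f t

namespace OddContinuous

variable {β : T → Cover m n} {f g : T → ℝ}

theorem comp {T' : Type} [TopologicalSpace T'] (hf : OddContinuous β f) {h : T' → T}
    (hh : Continuous h) : OddContinuous (fun t => β (h t)) fun t => f (h t) :=
  fun s => (hf s).comp hh

/-- The two signs cancel: since `∑ x_s² = 1`, one has `f g = ∑ (x_s f) (x_s g)`. -/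
theorem mul (hf : OddContinuous β f) (hg : OddContinuous β g) : Continuous fun t => f t * g t := by
  refine (continuous_finsetSum Finset.univ fun s _ => (hf s).mul (hg s)).congr fun t => ?_
  rw [← one_mul (f t * g t), ← sum_coord_mul_coord 0 (β t), Finset.sum_mul]
  exact Finset.sum_congr rfl fun s _ => by simp only [Pi.mul_apply]; ring

theorem mul_even (hf : OddContinuous β f) (hg : Continuous g) :
    OddContinuous β fun t => f t * g t :=
  fun s => ((hf s).mul hg).congr fun t => by simp only [Pi.mul_apply]; ring

theorem even_mul (hf : Continuous f) (hg : OddContinuous β g) :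
    OddContinuous β fun t => f t * g t :=
  fun s => (hf.mul (hg s)).congr fun t => by simp only [Pi.mul_apply]; ring

theorem add (hf : OddContinuous β f) (hg : OddContinuous β g) :
    OddContinuous β fun t => f t + g t :=
  fun s => ((hf s).add (hg s)).congr fun t => by simp only [Pi.add_apply]; ring

theorem sum {ι : Type} [Fintype ι] {f : ι → T → ℝ} (hf : ∀ i, OddContinuous β (f i)) :
    OddContinuous β fun t => ∑ i, f i t :=
  fun s => (continuous_finsetSum Finset.univ fun i _ => hf i s).congr fun t => by
    rw [Finset.mul_sum]

theorem of_odd {g : Cover m n → ℝ} (hg : Continuous g) (ho : ∀ q, g q.invol = -g q)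
    {ρ : T → PT m n} (hρ : Continuous ρ) :
    OddContinuous (fun t => (ρ t).lift) fun t => g (ρ t).lift :=
  fun s => continuous_of_even ((smooth_coord _).1.mul hg)
    (fun q => by rw [Pi.mul_apply, ho, coord_invol, neg_mul_neg, Pi.mul_apply]) hρ

end OddContinuous

theorem continuous_deriv_of_even {g : Cover m n → ℝ} (hg : Smooth g) (he : ∀ q, g q.invol = g q) :
    Continuous fun e : TangentBundle 𝓘(ℝ, ModelE m n) (PT m n) => (PT.lift e.1).deriv g e.2 := by
  refine PT.continuous_deriv (f := fun p => g p.lift) ?_ hg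
  funext q
  rcases PT.mk_eq_iff.1 (PT.mk_lift (PT.mk q)) with h | h
  · exact congrArg g h
  · exact (congrArg g h).trans (he q)

/-- The product rule with `∑ x_s² = 1` and `∑ x_s dx_s = 0`. For odd `g` it expresses `dg`, which
has no meaning on `P_T`, through the derivatives of the even functions `x_s g`, which descend. -/
theorem sum_coord_mul_deriv_coord_mul {g : Cover m n → ℝ} (hg : Smooth g) (q : Cover m n)
    (v : ModelE m n) :
    ∑ s, coord ⟨0, s⟩ q * deriv q (fun x => coord ⟨0, s⟩ x * g x) v = deriv q g v := by
  simp only [deriv_mul (smooth_coord _) hg, mul_add, Finset.sum_add_distrib, ← mul_assoc,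
    ← Finset.sum_mul]
  rw [sum_coord_mul_coord, sum_coord_mul_deriv, one_mul, zero_mul, add_zero]

theorem oddContinuous_deriv {g : Cover m n → ℝ} (hg : Smooth g) (ho : ∀ q, g q.invol = -g q) :
    OddContinuous (fun e : TangentBundle 𝓘(ℝ, ModelE m n) (PT m n) => PT.lift e.1)
      fun e => (PT.lift e.1).deriv g e.2 := by
  have hρ : Continuous fun e : TangentBundle 𝓘(ℝ, ModelE m n) (PT m n) => e.1 :=
    FiberBundle.continuous_proj _ _
  have h : (fun e : TangentBundle 𝓘(ℝ, ModelE m n) (PT m n) => (PT.lift e.1).deriv g e.2) =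
      fun e => ∑ s, coord ⟨0, s⟩ (PT.lift e.1) *
        (PT.lift e.1).deriv (fun x => coord ⟨0, s⟩ x * g x) e.2 := by
    exact funext fun e => (sum_coord_mul_deriv_coord_mul hg _ e.2).symm
  rw [h]
  exact OddContinuous.sum fun s =>
    (OddContinuous.of_odd (smooth_coord _).1 (coord_invol _) hρ).mul_even
    (continuous_deriv_of_even ((smooth_coord _).mul hg) fun q => by
      rw [ho, coord_invol, neg_mul_neg])

end Parity

/-! ### The bundles `η` and `ζ'_j`. -/

section Coordinates

/-- The coordinate `[x, w, t] ↦ x_{1, s} t` of `η`. -/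
def etaCoord (s : Fin (m 0 + 1)) : (eta m n).LocalCoord :=
  .ofCompat PT.isOpenQuotientMap_mk (fun q => Cover.coord ⟨0, s⟩ q • ContinuousLinearMap.id ℝ ℝ)
    ((Cover.smooth_coord _).1.smul continuous_const) (by
      rintro a b (⟨h, h'⟩ | ⟨h, h'⟩)
      · rw [h, h']
      · rw [h, h', Cover.coord_invol]
        simp)

theorem etaCoord_toFun (s : Fin (m 0 + 1)) (q : Cover m n) (t : ℝ) :
    (etaCoord s).toFun q t = Cover.coord ⟨0, s⟩ q * t := rfl

theorem mem_domain_etaCoord {s : Fin (m 0 + 1)} {q : Cover m n} (h : Cover.coord ⟨0, s⟩ q ≠ 0) :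
    PT.mk q ∈ (etaCoord (m := m) (n := n) s).domain :=
  ⟨q, ⟨ContinuousLinearEquiv.smulLeft (Units.mk0 _ h), by ext; simp⟩, rfl⟩

theorem coord_ne_zero_of_mem_domain {s : Fin (m 0 + 1)} {q : Cover m n}
    (h : PT.mk q ∈ (etaCoord (m := m) (n := n) s).domain) : Cover.coord ⟨0, s⟩ q ≠ 0 := by
  intro h0
  have h1 := ((etaCoord s).isInvertible h).injective (a₁ := 1) (a₂ := 0)
  rw [etaCoord_toFun, etaCoord_toFun, h0, zero_mul, zero_mul] at h1
  exact one_ne_zero (h1 rfl)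

theorem exists_mem_domain_etaCoord (b : PT m n) :
    ∃ s, b ∈ (etaCoord (m := m) (n := n) s).domain := by
  obtain ⟨q, rfl⟩ := PT.mk_surjective b
  obtain ⟨s, hs⟩ := Cover.exists_coord_ne_zero 0 q
  exact ⟨s, mem_domain_etaCoord hs⟩

/-- The coordinate `[x, y, z] ↦ Re (conj y_{j, t} z) + i x_{1, s} Im (conj y_{j, t} z)` of
`ζ'_j`. -/
def zetaCoord (j : Fin l) (a : Fin (m 0 + 1) × Fin (n j + 1)) : (zeta m n j).LocalCoord :=
  .ofCompat isOpenQuotientMap_hopf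
    (fun y => (Complex.reCLM.smulRight (1 : ℂ) +
      (y.1 0).1 a.1 • Complex.imCLM.smulRight Complex.I).comp
        (ContinuousLinearMap.mul ℝ ℂ (conj ((y.2 j).1 a.2))))
    (by
      have h1 : Continuous fun y : SphereProd m × OddSphereProd n => (y.1 0).1 a.1 :=
        (EuclideanSpace.proj a.1 : EuclideanSpace ℝ (Fin (m 0 + 1)) →L[ℝ] ℝ).continuous.comp
          (continuous_subtype_val.comp ((continuous_apply 0).comp continuous_fst))
      have h2 : Continuous fun y : SphereProd m × OddSphereProd n => (y.2 j).1 a.2 :=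
        (EuclideanSpace.proj a.2 : EuclideanSpace ℂ (Fin (n j + 1)) →L[ℂ] ℂ).continuous.comp
          (continuous_subtype_val.comp ((continuous_apply j).comp continuous_snd))
      refine Continuous.clm_comp (continuous_const.add (h1.smul continuous_const)) ?_
      exact (ContinuousLinearMap.mul ℝ ℂ).continuous.comp (Complex.continuous_conj.comp h2))
    (by
      have hc : ∀ (g : Circle) (u z : ℂ), conj (g * u) * (g * z) = conj u * z := fun g u z => by
        have hg : conj (g : ℂ) * g = 1 := by
          rw [← Circle.coe_inv_eq_conj, ← Circle.coe_mul, inv_mul_cancel, Circle.coe_one]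
        rw [map_mul, mul_mul_mul_comm, hg, one_mul]
      rintro a' b ⟨h, ⟨h1, h2, h3⟩ | ⟨h1, h2, h3⟩⟩
      · simp only [ContinuousLinearMap.comp_apply, ContinuousLinearMap.mul_apply', h1, h2, h3, hc]
      · simp only [ContinuousLinearMap.comp_apply, ContinuousLinearMap.mul_apply', h1, h2, h3,
          ← map_mul conj (conj _) _, hc]
        -- The circle factors have cancelled in `conj y_t * z`, which the involution conjugates. The
        -- real part is unchanged, and the sign of the imaginary part cancels against the sign of
        -- the sphere coordinate.
        simp only [add_apply, smul_apply, ContinuousLinearMap.smulRight_apply,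
          Complex.reCLM_apply, Complex.imCLM_apply, Complex.conj_re, Complex.conj_im,
          coe_neg_sphere, PiLp.neg_apply, neg_smul, smul_neg, neg_neg])

theorem zetaCoord_toFun (j : Fin l) (a : Fin (m 0 + 1) × Fin (n j + 1))
    (y : SphereProd m × OddSphereProd n) (z : ℂ) :
    (zetaCoord j a).toFun y z = ((conj ((y.2 j).1 a.2) * z).re : ℂ) +
      (((y.1 0).1 a.1 * (conj ((y.2 j).1 a.2) * z).im : ℝ) : ℂ) * Complex.I := by
  change Complex.re _ • (1 : ℂ) + (y.1 0).1 a.1 • (Complex.im _ • Complex.I) = _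
  rw [smul_smul, Complex.real_smul, Complex.real_smul, mul_one]
  rfl

/-- The coordinate is injective as soon as the chosen components of `x₁` and `y_j` are nonzero, and
unit vectors have nonzero components. Injectivity suffices in finite dimension. -/
theorem exists_mem_domain_zetaCoord (j : Fin l) (b : PT m n) :
    ∃ a, b ∈ (zetaCoord (m := m) (n := n) j a).domain := by
  obtain ⟨y, rfl⟩ := isOpenQuotientMap_hopf.surjective b
  obtain ⟨s, hs⟩ := Cover.exists_coord_ne_zero 0
    ((y.1, fun j => CP.ofSphere (y.2 j)) : Cover m n)
  replace hs : (y.1 0).1 s ≠ 0 := hs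
  obtain ⟨t, ht⟩ := CP.exists_coord ⟨(y.2 j).1, ne_zero_of_mem_unit_sphere (y.2 j)⟩
  refine ⟨(s, t), y, ?_, rfl⟩
  change ((zetaCoord j (s, t)).toFun y).IsInvertible
  have hi : LinearMap.ker ((zetaCoord j (s, t)).toFun y).toLinearMap = ⊥ := by
    rw [LinearMap.ker_eq_bot']
    intro z hz
    change (zetaCoord j (s, t)).toFun y z = 0 at hz
    rw [zetaCoord_toFun, ← Complex.mk_eq_add_mul_I, Complex.ext_iff] at hz
    have h1 : conj ((y.2 j).1 t) * z = 0 :=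
      Complex.ext hz.1 ((mul_eq_zero.1 hz.2).resolve_left hs)
    exact (mul_eq_zero.1 h1).resolve_left ((map_ne_zero _).2 ht)
  exact ⟨(LinearEquiv.ofInjectiveEndo _ (LinearMap.ker_eq_bot.1 hi)).toContinuousLinearEquiv, by
    ext; rfl⟩

theorem isRealVectorBundle_eta : IsRealVectorBundle ℝ (eta m n).Fiber :=
  Identification.isRealVectorBundle PT.isOpenQuotientMap_mk etaCoord exists_mem_domain_etaCoord

theorem isRealVectorBundle_zeta (j : Fin l) : IsRealVectorBundle ℂ (zeta m n j).Fiber :=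
  Identification.isRealVectorBundle isOpenQuotientMap_hopf (zetaCoord j)
    (exists_mem_domain_zetaCoord j)

end Coordinates

end OddFunctions

variable {k l : ℕ} {m : Fin k → ℕ} {n : Fin l → ℕ}

theorem continuous_prod_iff {B F₁ F₂ T : Type} {E₁ E₂ : B → Type}
    [TopologicalSpace (TotalSpace F₁ E₁)] [TopologicalSpace (TotalSpace F₂ E₂)]
    [TopologicalSpace T] {f : T → TotalSpace (F₁ × F₂) (E₁ ×ᵇ E₂)} :
    Continuous f ↔ (Continuous fun t => (⟨(f t).1, (f t).2.1⟩ : TotalSpace F₁ E₁)) ∧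
      Continuous fun t => (⟨(f t).1, (f t).2.2⟩ : TotalSpace F₂ E₂) :=
  (FiberBundle.Prod.isInducing_diag F₁ E₁ F₂ E₂).continuous_iff.trans continuous_prodMk

theorem continuous_whitneySum_iff {B ι T : Type} [TopologicalSpace B] {F : ι → Type}
    {E : ι → B → Type} [∀ i, TopologicalSpace (TotalSpace (F i) (E i))] [TopologicalSpace T]
    {f : T → TotalSpace (∀ i, F i) (WhitneySum E)} :
    Continuous f ↔ (Continuous fun t => (f t).1) ∧
      ∀ i, Continuous fun t => (⟨(f t).1, (f t).2 i⟩ : TotalSpace (F i) (E i)) := by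
  refine continuous_induced_rng.trans (continuous_prodMk.trans ?_)
  rw [continuous_pi_iff]

/-! ### The isomorphism on a single fibre. -/

section Model

/-- The model of the source fibre. -/
abbrev SourceModel (m : Fin k → ℕ) (n : Fin l → ℕ) : Type :=
  (ModelE m n × (Fin l → ℝ)) × (Fin (k + l) → ℝ)

/-- The model of the target fibre. -/
abbrev TargetModel (m : Fin k → ℕ) (n : Fin l → ℕ) : Type :=
  ((Σ i, Fin (m i + 1)) → ℝ) × ((Σ j, Fin (n j + 1)) → ℂ)

/-- The map of fibres, in terms of a point of the double cover and unit vectors spanning the lines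
in its projective factors: a tangent vector goes to the variation of the vectors, `ε` to the
multiples of the vectors, and `η` to the imaginary multiples of the vectors. -/
def modelMap (q : Cover m n) (u : OddSphereProd n) : SourceModel m n →ₗ[ℝ] TargetModel m n where
  toFun e := (fun a => q.deriv (Cover.coord a) e.1.1 + e.2 (Fin.castAdd l a.1) * Cover.coord a q,
    fun c => ∑ t, q.deriv (Cover.herm c.1 c.2 t) e.1.1 * (u c.1).1 t +
      ((e.2 (Fin.natAdd k c.1) : ℂ) + e.1.2 c.1 * Complex.I) * (u c.1).1 c.2)
  map_add' e e' := by
    refine Prod.ext (funext fun a => ?_) (funext fun c => ?_)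
    · simp only [Prod.fst_add, Prod.snd_add, map_add, Pi.add_apply]
      ring
    · simp only [Prod.fst_add, Prod.snd_add, map_add, Pi.add_apply, add_mul,
        Finset.sum_add_distrib, Complex.ofReal_add]
      ring
  map_smul' r e := by
    refine Prod.ext (funext fun a => ?_) (funext fun c => ?_)
    · simp only [Prod.smul_fst, Prod.smul_snd, map_smul, Pi.smul_apply, smul_eq_mul,
        RingHom.id_apply]
      ring
    · simp only [Prod.smul_fst, Prod.smul_snd, map_smul, Pi.smul_apply, smul_eq_mul,
        RingHom.id_apply, Complex.real_smul, Complex.ofReal_mul, mul_assoc, ← Finset.mul_sum]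
      ring

/-- The factors separate. On a sphere, `dx` is tangent and `t x` normal, so both vanish; on a
projective space, `dP u + (t + i c) u = 0` forces `dP = 0` and `t + i c = 0`. Vanishing of all `dx`
and `dP` kills the tangent vector. -/
theorem modelMap_injective {q : Cover m n} {u : OddSphereProd n}
    (hu : ∀ j, CP.ofSphere (u j) = q.2 j) : Function.Injective (modelMap q u) := by
  rw [← LinearMap.ker_eq_bot, LinearMap.ker_eq_bot']
  rintro ⟨⟨v, c⟩, t⟩ h
  have h1 : ∀ i s, q.deriv (Cover.coord ⟨i, s⟩) v +
      t (Fin.castAdd l i) * Cover.coord ⟨i, s⟩ q = 0 :=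
    fun i s => congrFun (congrArg Prod.fst h) ⟨i, s⟩
  have h2 : ∀ j s, ∑ r, q.deriv (Cover.herm j s r) v * (u j).1 r +
      ((t (Fin.natAdd k j) : ℂ) + c j * Complex.I) * (u j).1 s = 0 :=
    fun j s => congrFun (congrArg Prod.snd h) ⟨j, s⟩
  have ht : ∀ i, t (Fin.castAdd l i) = 0 := fun i => by
    -- The inner product with `x` annihilates the tangential part and leaves `t`.
    have h3 := Finset.sum_congr rfl fun s (_ : s ∈ Finset.univ) =>
      congrArg (Cover.coord ⟨i, s⟩ q * ·) (h1 i s)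
    simp only [mul_add, mul_zero, Finset.sum_add_distrib, Cover.sum_coord_mul_deriv, zero_add,
      mul_left_comm _ (t _), ← Finset.mul_sum, Cover.sum_coord_mul_coord, mul_one,
      Finset.sum_const_zero] at h3
    exact h3
  have hv1 : ∀ i, v.1 i = 0 := fun i => Cover.eq_zero_of_deriv_coord fun s => by
    have h3 := h1 i s
    rwa [ht, zero_mul, add_zero] at h3
  have hherm : ∀ j s r, Cover.herm j s r q = (u j).1 s * conj ((u j).1 r) := fun j s r => by
    rw [Cover.herm, ← hu, CP.herm_ofSphere]
  have key : ∀ j, (t (Fin.natAdd k j) : ℂ) + c j * Complex.I = 0 ∧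
      (Matrix.of fun s r => q.deriv (Cover.herm j s r) v) = 0 := fun j => by
    refine eq_zero_of_projection_variation (fun s => (u j).1 s) ?_ _ ?_ ?_ _ ?_
    · have h3 := congrArg (fun x : ℝ => (x : ℂ)) (CP.sum_normSq (u j))
      simp only [Complex.ofReal_sum, Complex.normSq_eq_conj_mul_self, Complex.ofReal_one] at h3
      exact h3
    · ext s r
      refine Eq.trans ?_ (Cover.deriv_herm_eq j s r q v)
      simp only [hherm]
      rw [Finset.sum_add_distrib]
      rfl
    · ext s r
      exact Cover.conj_deriv_herm j r s q v
    · exact funext fun s => h2 j s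
  have hv2 : ∀ j, v.2 j = 0 := fun j => Cover.eq_zero_of_deriv_herm fun s r =>
    congrFun (congrFun (key j).2 s) r
  have hct : ∀ j, t (Fin.natAdd k j) = 0 ∧ c j = 0 := fun j => by
    have h3 := (key j).1
    rw [← Complex.mk_eq_add_mul_I, Complex.ext_iff] at h3
    exact h3
  refine Prod.ext (Prod.ext (Prod.ext (funext hv1) (funext hv2)) (funext fun j => (hct j).2))
    (funext fun i => ?_)
  refine Fin.addCases ht (fun j => (hct j).1) i

/-- Both sides are `∑ (m_i + 1) + 2 ∑ (n_j + 1)`: each sphere gains one dimension from `ε`, each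
projective space two, from `ε` and `η`. -/
theorem finrank_model :
    Module.finrank ℝ (SourceModel m n) = Module.finrank ℝ (TargetModel m n) := by
  simp only [Module.finrank_prod, Module.finrank_pi_fintype, finrank_euclideanSpace_fin,
    Module.finrank_self, Complex.finrank_real_complex, Finset.sum_const, Finset.card_univ,
    Fintype.card_fin, Fintype.card_sigma, smul_eq_mul, mul_one, Finset.sum_add_distrib,
    ← Finset.sum_mul]
  ring

/-- `modelMap` as an isomorphism. -/
def modelEquiv (q : Cover m n) (u : OddSphereProd n) (hu : ∀ j, CP.ofSphere (u j) = q.2 j) :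
    SourceModel m n ≃ₗ[ℝ] TargetModel m n :=
  (modelMap q u).linearEquivOfInjective (modelMap_injective hu) finrank_model

end Model

namespace Cover

theorem smooth_herm_re (j : Fin l) (s t : Fin (n j + 1)) :
    Smooth fun q : Cover m n => (herm j s t q).re := (smooth_herm j s t).clm_comp Complex.reCLM

theorem smooth_herm_im (j : Fin l) (s t : Fin (n j + 1)) :
    Smooth fun q : Cover m n => (herm j s t q).im := (smooth_herm j s t).clm_comp Complex.imCLM

theorem herm_re_invol (j : Fin l) (s t : Fin (n j + 1)) (q : Cover m n) :
    (herm j s t q.invol).re = (herm j s t q).re := by rw [herm_invol, Complex.conj_re]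

theorem herm_im_invol (j : Fin l) (s t : Fin (n j + 1)) (q : Cover m n) :
    (herm j s t q.invol).im = -(herm j s t q).im := by rw [herm_invol, Complex.conj_im]

end Cover

/-! ### The isomorphism over `P_T` and its continuity. -/

section Iso

variable [NeZero k]

/-- Unit vectors spanning the lines in the projective factors of `b.lift`. -/
def unitVectors (b : PT m n) : OddSphereProd n :=
  fun j => (CP.ofSphere_surjective (b.lift.2 j)).choose

theorem ofSphere_unitVectors (b : PT m n) (j : Fin l) :
    CP.ofSphere (unitVectors b j) = b.lift.2 j :=
  (CP.ofSphere_surjective (b.lift.2 j)).choose_spec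

theorem hopf_unitVectors (b : PT m n) : hopf m n (b.lift.1, unitVectors b) = b := by
  refine Eq.trans (congrArg PT.mk ?_) (PT.mk_lift b)
  exact Prod.ext rfl (funext fun j => ofSphere_unitVectors b j)

/-- The unit vectors are chosen without continuity. These products do not depend on the choice of
phase, and continuity arguments use the vectors only through them. -/
theorem unitVectors_mul_conj (b : PT m n) (j : Fin l) (s t : Fin (n j + 1)) :
    (unitVectors b j).1 s * conj ((unitVectors b j).1 t) = b.lift.herm j s t := by
  rw [Cover.herm, ← ofSphere_unitVectors, CP.herm_ofSphere]

variable (m n) in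
/-- `T P_T ⊕ l η ⊕ (k + l) ε`. -/
abbrev SourceBundle : PT m n → Type :=
  ((TangentSpace 𝓘(ℝ, ModelE m n) : PT m n → Type) ×ᵇ
    WhitneySum (fun _ : Fin l => (eta m n).Fiber)) ×ᵇ
    WhitneySum (fun _ : Fin (k + l) => Bundle.Trivial (PT m n) ℝ)

variable (m n) in
/-- `(∑ i, (m i + 1)) η ⊕ ⨁ j, (n j + 1) ζ'_j`. -/
abbrev TargetBundle : PT m n → Type :=
  WhitneySum (fun _ : Σ i, Fin (m i + 1) => (eta m n).Fiber) ×ᵇ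
    WhitneySum (fun s : Σ j, Fin (n j + 1) => (zeta m n s.1).Fiber)

/-- The fibre of `η` over `b` in terms of the representative `b.lift`. -/
def etaFrame (b : PT m n) : ℝ ≃ₗ[ℝ] (eta m n).Fiber b :=
  (eta m n).fiberLinearEquiv b.lift (PT.mk_lift b)

/-- The fibre of `ζ'_j` over `b` in terms of the representative `b.lift`. -/
def zetaFrame (j : Fin l) (b : PT m n) : ℂ ≃ₗ[ℝ] (zeta m n j).Fiber b :=
  (zeta m n j).fiberLinearEquiv (b.lift.1, unitVectors b) (hopf_unitVectors b)

/-- The coordinates of the source fibre. -/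
def sourceEquiv (b : PT m n) : SourceBundle m n b ≃ₗ[ℝ] SourceModel m n :=
  LinearEquiv.prodCongr (LinearEquiv.prodCongr (LinearEquiv.refl ℝ (ModelE m n))
    (LinearEquiv.piCongrRight fun _ => (etaFrame b).symm)) (LinearEquiv.refl ℝ (Fin (k + l) → ℝ))

/-- The coordinates of the target fibre. -/
def targetEquiv (b : PT m n) : TargetModel m n ≃ₗ[ℝ] TargetBundle m n b :=
  LinearEquiv.prodCongr (LinearEquiv.piCongrRight fun _ => etaFrame b)
    (LinearEquiv.piCongrRight fun c => zetaFrame c.1 b)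

/-- The isomorphism of the fibres over `b`. -/
def fiberIso (b : PT m n) : SourceBundle m n b ≃ₗ[ℝ] TargetBundle m n b :=
  (sourceEquiv b).trans
    ((modelEquiv b.lift (unitVectors b) (ofSphere_unitVectors b)).trans (targetEquiv b))

theorem eval_etaFrame (s : Fin (m 0 + 1)) (b : PT m n) (t : ℝ) :
    (etaCoord s).eval ⟨b, etaFrame b t⟩ = Cover.coord ⟨0, s⟩ b.lift * t :=
  (etaCoord s).eval_mk _ _ _

/-- The coordinates of the section are the products `x_s f`, so `OddContinuous` is exactly the
condition of being a continuous section of `η`. -/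
theorem continuous_etaFrame {T : Type} [TopologicalSpace T] {ρ : T → PT m n} (hρ : Continuous ρ)
    {f : T → ℝ} (hf : OddContinuous (fun t => (ρ t).lift) f) :
    Continuous fun t => (⟨ρ t, etaFrame (ρ t) (f t)⟩ : TotalSpace ℝ (eta m n).Fiber) :=
  Identification.continuous_of_eval PT.isOpenQuotientMap_mk etaCoord exists_mem_domain_etaCoord hρ
    fun s => (hf s).congr fun _ => (eval_etaFrame s _ _).symm

theorem oddContinuous_etaFrame_symm :
    OddContinuous (fun e : TotalSpace ℝ (eta m n).Fiber => e.1.lift)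
      fun e => (etaFrame e.1).symm e.2 :=
  fun s => (etaCoord s).continuous_eval.congr fun e =>
    (etaCoord s).eval_eq e.1.lift (PT.mk_lift e.1) e.2

/-- The coordinates on `ζ'_j` see `f` only through `conj u_t * f`, with the imaginary part
multiplied by `x_s`; hence an even condition on the real part and an odd one on the imaginary part.
-/
theorem continuous_zetaFrame {T : Type} [TopologicalSpace T] {ρ : T → PT m n} (hρ : Continuous ρ)
    (j : Fin l) {f : T → ℂ}
    (h1 : ∀ t, Continuous fun x => (conj ((unitVectors (ρ x) j).1 t) * f x).re)
    (h2 : ∀ t, OddContinuous (fun x => (ρ x).lift)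
      fun x => (conj ((unitVectors (ρ x) j).1 t) * f x).im) :
    Continuous fun t => (⟨ρ t, zetaFrame j (ρ t) (f t)⟩ : TotalSpace ℂ (zeta m n j).Fiber) := by
  refine Identification.continuous_of_eval isOpenQuotientMap_hopf (zetaCoord j)
    (exists_mem_domain_zetaCoord j) hρ fun a => ?_
  refine ((Complex.continuous_ofReal.comp (h1 a.2)).add ((Complex.continuous_ofReal.comp
    (h2 a.2 a.1)).mul (continuous_const (y := Complex.I)))).congr fun t => ?_
  exact (((zetaCoord j a).eval_mk _ (hopf_unitVectors (ρ t)) (f t)).trans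
    (zetaCoord_toFun j a _ _)).symm


section Source

theorem continuous_tangentPart :
    Continuous fun e : TotalSpace (SourceModel m n) (SourceBundle m n) =>
      (⟨e.1, e.2.1.1⟩ : TangentBundle 𝓘(ℝ, ModelE m n) (PT m n)) :=
  (continuous_prod_iff.1 (continuous_prod_iff.1 continuous_id).1).1

theorem continuous_source_proj :
    Continuous fun e : TotalSpace (SourceModel m n) (SourceBundle m n) => e.1 :=
  (FiberBundle.continuous_proj (ModelE m n)
    (TangentSpace 𝓘(ℝ, ModelE m n) : PT m n → Type)).comp continuous_tangentPart

theorem oddContinuous_etaPart (j : Fin l) :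
    OddContinuous (fun e : TotalSpace (SourceModel m n) (SourceBundle m n) => e.1.lift)
      fun e => (sourceEquiv e.1 e.2).1.2 j := by
  have h : Continuous fun e : TotalSpace (SourceModel m n) (SourceBundle m n) =>
      (⟨e.1, e.2.1.2 j⟩ : TotalSpace ℝ (eta m n).Fiber) :=
    (continuous_whitneySum_iff.1
      (continuous_prod_iff.1 (continuous_prod_iff.1 continuous_id).1).2).2 j
  exact oddContinuous_etaFrame_symm.comp h

theorem continuous_trivialPart (i : Fin (k + l)) :
    Continuous fun e : TotalSpace (SourceModel m n) (SourceBundle m n) =>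
      (sourceEquiv e.1 e.2).2 i := by
  have h := (continuous_whitneySum_iff.1 (continuous_prod_iff.1 (continuous_id
    (X := TotalSpace (SourceModel m n) (SourceBundle m n)))).2).2 i
  have h2 : Continuous fun x : TotalSpace ℝ (Bundle.Trivial (PT m n) ℝ) => (x.2 : ℝ) :=
    continuous_snd.comp (Bundle.Trivial.homeomorphProd (PT m n) ℝ).continuous
  exact h2.comp h

end Source

section HermParts

open Cover

theorem continuous_deriv_herm_re (j : Fin l) (s t : Fin (n j + 1)) :
    Continuous fun e : TangentBundle 𝓘(ℝ, ModelE m n) (PT m n) =>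
      (e.1.lift.deriv (herm j s t) e.2).re :=
  (continuous_deriv_of_even (smooth_herm_re j s t) (herm_re_invol j s t)).congr fun e =>
    deriv_clm_comp Complex.reCLM (smooth_herm j s t) e.1.lift e.2

theorem oddContinuous_deriv_herm_im (j : Fin l) (s t : Fin (n j + 1)) :
    OddContinuous (fun e : TangentBundle 𝓘(ℝ, ModelE m n) (PT m n) => e.1.lift) fun e =>
      (e.1.lift.deriv (herm j s t) e.2).im := by
  have h := oddContinuous_deriv (smooth_herm_im (m := m) j s t) (herm_im_invol j s t)
  have e : (fun e : TangentBundle 𝓘(ℝ, ModelE m n) (PT m n) => e.1.lift.deriv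
      (fun q => (herm j s t q).im) e.2) = fun e => (e.1.lift.deriv (herm j s t) e.2).im :=
    funext fun e => deriv_clm_comp Complex.imCLM (smooth_herm j s t) e.1.lift e.2
  rwa [e] at h

theorem continuous_source_deriv_herm_re (j : Fin l) (s t : Fin (n j + 1)) :
    Continuous fun e : TotalSpace (SourceModel m n) (SourceBundle m n) =>
      (e.1.lift.deriv (herm j s t) (sourceEquiv e.1 e.2).1.1).re := by
  have h := (continuous_deriv_herm_re (m := m) j s t).comp continuous_tangentPart
  exact h

theorem oddContinuous_source_deriv_herm_im (j : Fin l) (s t : Fin (n j + 1)) :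
    OddContinuous (fun e : TotalSpace (SourceModel m n) (SourceBundle m n) => e.1.lift) fun e =>
      (e.1.lift.deriv (herm j s t) (sourceEquiv e.1 e.2).1.1).im :=
  (oddContinuous_deriv_herm_im j s t).comp continuous_tangentPart

theorem continuous_source_herm_re (j : Fin l) (s t : Fin (n j + 1)) :
    Continuous fun e : TotalSpace (SourceModel m n) (SourceBundle m n) =>
      (herm j s t e.1.lift).re :=
  continuous_of_even (smooth_herm_re j s t).1 (herm_re_invol j s t) continuous_source_proj

theorem oddContinuous_source_herm_im (j : Fin l) (s t : Fin (n j + 1)) :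
    OddContinuous (fun e : TotalSpace (SourceModel m n) (SourceBundle m n) => e.1.lift) fun e =>
      (herm j s t e.1.lift).im :=
  OddContinuous.of_odd (smooth_herm_im j s t).1 (herm_im_invol j s t) continuous_source_proj

end HermParts

/-- The factor `conj u_t` combines with the `u` in `modelMap` to entries of `P`, so the right-hand
side is free of the choice of unit vectors. -/
theorem conj_mul_modelMap (b : PT m n) (e : SourceModel m n) (c : Σ j, Fin (n j + 1))
    (t : Fin (n c.1 + 1)) :
    conj ((unitVectors b c.1).1 t) * (modelMap b.lift (unitVectors b) e).2 c =
      ∑ r, b.lift.deriv (Cover.herm c.1 c.2 r) e.1.1 * b.lift.herm c.1 r t +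
        ((e.2 (Fin.natAdd k c.1) : ℂ) + e.1.2 c.1 * Complex.I) * b.lift.herm c.1 c.2 t := by
  simp only [modelMap, LinearMap.coe_mk, AddHom.coe_mk, mul_add, Finset.mul_sum,
    ← unitVectors_mul_conj]
  congr 1
  · exact Finset.sum_congr rfl fun r _ => by ring
  · ring

/-- Real parts of `P` and `dP` and the `ε` coefficient are even; imaginary parts and the `η`
coefficient are odd. Every term of the real part is even times even or odd times odd; in the
imaginary part each term is mixed. -/
theorem continuous_conj_mul_modelMap_re (c : Σ j, Fin (n j + 1)) (t : Fin (n c.1 + 1)) :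
    Continuous fun e : TotalSpace (SourceModel m n) (SourceBundle m n) =>
      (conj ((unitVectors e.1 c.1).1 t) *
        (modelMap e.1.lift (unitVectors e.1) (sourceEquiv e.1 e.2)).2 c).re := by
  simp only [conj_mul_modelMap, Complex.add_re, Complex.re_sum, Complex.mul_re, Complex.add_im,
    Complex.mul_im, Complex.ofReal_re, Complex.ofReal_im, Complex.I_re, Complex.I_im, mul_zero,
    mul_one, zero_add, add_zero, sub_zero]
  refine (continuous_finsetSum _ fun r _ => Continuous.sub (Continuous.mul ?_ ?_) ?_).add
    (Continuous.sub (Continuous.mul ?_ ?_) ?_)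
  · exact continuous_source_deriv_herm_re c.1 c.2 r
  · exact continuous_source_herm_re c.1 r t
  · exact (oddContinuous_source_deriv_herm_im c.1 c.2 r).mul
      (oddContinuous_source_herm_im c.1 r t)
  · exact continuous_trivialPart _
  · exact continuous_source_herm_re c.1 c.2 t
  · exact (oddContinuous_etaPart c.1).mul
      (oddContinuous_source_herm_im c.1 c.2 t)

theorem oddContinuous_conj_mul_modelMap_im (c : Σ j, Fin (n j + 1)) (t : Fin (n c.1 + 1)) :
    OddContinuous (fun e : TotalSpace (SourceModel m n) (SourceBundle m n) => e.1.lift) fun e =>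
      (conj ((unitVectors e.1 c.1).1 t) *
        (modelMap e.1.lift (unitVectors e.1) (sourceEquiv e.1 e.2)).2 c).im := by
  simp only [conj_mul_modelMap, Complex.add_re, Complex.im_sum, Complex.mul_re, Complex.add_im,
    Complex.mul_im, Complex.ofReal_re, Complex.ofReal_im, Complex.I_re, Complex.I_im, mul_zero,
    mul_one, zero_add, add_zero, sub_zero]
  refine (OddContinuous.sum fun r => OddContinuous.add (OddContinuous.even_mul ?_ ?_)
    (OddContinuous.mul_even ?_ ?_)).add
    (OddContinuous.add (OddContinuous.even_mul ?_ ?_) (OddContinuous.mul_even ?_ ?_))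
  · exact continuous_source_deriv_herm_re c.1 c.2 r
  · exact oddContinuous_source_herm_im c.1 r t
  · exact oddContinuous_source_deriv_herm_im c.1 c.2 r
  · exact continuous_source_herm_re c.1 r t
  · exact continuous_trivialPart _
  · exact oddContinuous_source_herm_im c.1 c.2 t
  · exact oddContinuous_etaPart c.1
  · exact continuous_source_herm_re c.1 c.2 t

theorem continuous_fiberIso :
    Continuous fun e : TotalSpace (SourceModel m n) (SourceBundle m n) =>
      (⟨e.1, fiberIso e.1 e.2⟩ : TotalSpace (TargetModel m n) (TargetBundle m n)) := by
  have hρ := continuous_source_proj (m := m) (n := n)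
  refine continuous_prod_iff.2 ⟨continuous_whitneySum_iff.2 ⟨hρ, fun a => ?_⟩,
    continuous_whitneySum_iff.2 ⟨hρ, fun c => ?_⟩⟩
  · refine continuous_etaFrame hρ (f := fun e =>
      (modelMap e.1.lift (unitVectors e.1) (sourceEquiv e.1 e.2)).1 a) ?_
    exact ((oddContinuous_deriv (Cover.smooth_coord a) (Cover.coord_invol a)).comp
      continuous_tangentPart).add (OddContinuous.even_mul (continuous_trivialPart _)
        (OddContinuous.of_odd (Cover.smooth_coord a).1 (Cover.coord_invol a) hρ))
  · exact continuous_zetaFrame hρ c.1 (f := fun e =>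
      (modelMap e.1.lift (unitVectors e.1) (sourceEquiv e.1 e.2)).2 c)
      (continuous_conj_mul_modelMap_re c) (oddContinuous_conj_mul_modelMap_im c)

theorem continuous_target_proj :
    Continuous (TotalSpace.proj : TotalSpace (TargetModel m n) (TargetBundle m n) → PT m n) :=
  (continuous_whitneySum_iff.1 (continuous_prod_iff.1 continuous_id).1).1

/-- The coordinates of the target bundle. -/
def targetCoord (b : PT m n) : TargetBundle m n b →ₗ[ℝ]
    ((Σ i, Fin (m i + 1)) → Fin (m 0 + 1) → ℝ) ×
      (∀ c : Σ j, Fin (n j + 1), Fin (m 0 + 1) × Fin (n c.1 + 1) → ℂ) :=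
  LinearMap.prodMap
    (LinearMap.pi fun a => (LinearMap.pi fun s => ((etaCoord s).isLinearMap_eval b).mk' _) ∘ₗ
      LinearMap.proj a)
    (LinearMap.pi fun c => (LinearMap.pi fun a => ((zetaCoord c.1 a).isLinearMap_eval b).mk' _) ∘ₗ
      LinearMap.proj c)

/-- The domains of the coordinates cover `P_T`, so all coordinates together embed each fibre in one
fixed space. This is the `ψ` of `continuous_symm_of_frames`. -/
theorem targetCoord_injective (b : PT m n) : Function.Injective (targetCoord b) := by
  intro e e' h
  refine Prod.ext (funext fun a => ?_) (funext fun c => ?_)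
  · obtain ⟨s, hs⟩ := exists_mem_domain_etaCoord b
    exact (etaCoord s).eval_injective hs (congrFun (congrFun (congrArg Prod.fst h) a) s)
  · obtain ⟨a, ha⟩ := exists_mem_domain_zetaCoord c.1 b
    exact (zetaCoord c.1 a).eval_injective ha (congrFun (congrFun (congrArg Prod.snd h) c) a)

theorem continuous_targetCoord :
    Continuous fun e : TotalSpace (TargetModel m n) (TargetBundle m n) => targetCoord e.1 e.2 := by
  have h := continuous_prod_iff.1 (continuous_id
    (X := TotalSpace (TargetModel m n) (TargetBundle m n)))
  refine Continuous.prodMk (continuous_pi fun a => continuous_pi fun s => ?_)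
    (continuous_pi fun c => continuous_pi fun a => ?_)
  · exact (etaCoord s).continuous_eval.comp ((continuous_whitneySum_iff.1 h.1).2 a)
  · exact (zetaCoord c.1 a).continuous_eval.comp ((continuous_whitneySum_iff.1 h.2).2 c)

/-- A local frame of the source bundle, given by a trivialization of the tangent bundle and by a
coordinate of the first sphere as a section of `η`. -/
def sourceFrame (τ : Trivialization (ModelE m n) (TotalSpace.proj :
      TangentBundle 𝓘(ℝ, ModelE m n) (PT m n) → PT m n)) [τ.IsLinear ℝ] (s : Fin (m 0 + 1))
    (b : PT m n) : SourceModel m n →ₗ[ℝ] SourceBundle m n b :=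
  LinearMap.prodMap (LinearMap.prodMap (τ.symmₗ ℝ b) (LinearMap.pi fun j =>
    ((etaFrame b).toLinearMap ∘ₗ (Cover.coord ⟨0, s⟩ b.lift • LinearMap.id)) ∘ₗ
      LinearMap.proj j)) LinearMap.id

theorem sourceFrame_bijective (τ : Trivialization (ModelE m n) (TotalSpace.proj :
      TangentBundle 𝓘(ℝ, ModelE m n) (PT m n) → PT m n)) [τ.IsLinear ℝ] (s : Fin (m 0 + 1))
    {b : PT m n} (hb : b ∈ τ.baseSet) (hs : Cover.coord ⟨0, s⟩ b.lift ≠ 0) :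
    Function.Bijective (sourceFrame τ s b) := by
  have h1 : Function.Bijective (τ.symmₗ ℝ b) := by
    rw [τ.coe_symmₗ hb]
    exact (τ.linearEquivAt ℝ b hb).symm.bijective
  have h2 : Function.Bijective fun c : ℝ => etaFrame b (Cover.coord ⟨0, s⟩ b.lift * c) :=
    (etaFrame b).bijective.comp (mulLeft_bijective₀ _ hs)
  exact (h1.prodMap (Function.Bijective.piMap fun _ : Fin l => h2)).prodMap Function.bijective_id

theorem continuousOn_sourceFrame (τ : Trivialization (ModelE m n) (TotalSpace.proj :
      TangentBundle 𝓘(ℝ, ModelE m n) (PT m n) → PT m n)) [τ.IsLinear ℝ] (s : Fin (m 0 + 1)) :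
    ContinuousOn (fun p : PT m n × SourceModel m n =>
      (⟨p.1, sourceFrame τ s p.1 p.2⟩ : TotalSpace (SourceModel m n) (SourceBundle m n)))
      (τ.baseSet ×ˢ univ) := by
  rw [continuousOn_iff_continuous_domRestrict]
  have hρ : Continuous fun p : ↥(τ.baseSet ×ˢ (univ : Set (SourceModel m n))) => p.1.1 :=
    continuous_fst.comp continuous_subtype_val
  refine continuous_prod_iff.2 ⟨continuous_prod_iff.2 ⟨?_, ?_⟩, ?_⟩
  · refine (τ.continuousOn_symm.comp_continuous (f := fun p : ↥(τ.baseSet ×ˢ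
      (univ : Set (SourceModel m n))) => (p.1.1, p.1.2.1.1)) (by fun_prop)
      fun p => ⟨p.2.1, mem_univ _⟩).congr fun p => ?_
    exact congrArg (TotalSpace.mk p.1.1) (τ.symmₗ_apply p.2.1 p.1.2.1.1).symm
  · refine continuous_whitneySum_iff.2 ⟨hρ, fun j => ?_⟩
    exact continuous_etaFrame hρ (f := fun p => Cover.coord ⟨0, s⟩ p.1.1.lift * p.1.2.1.2 j)
      ((OddContinuous.of_odd (Cover.smooth_coord _).1 (Cover.coord_invol _) hρ).mul_even
        (by fun_prop))
  · refine continuous_whitneySum_iff.2 ⟨hρ, fun i =>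
      (Bundle.Trivial.homeomorphProd (PT m n) ℝ).isInducing.continuous_iff.2 ?_⟩
    have h : Continuous fun p : ↥(τ.baseSet ×ˢ (univ : Set (SourceModel m n))) => p.1.2.2 i := by
      fun_prop
    exact hρ.prodMk h

theorem continuous_fiberIso_symm :
    Continuous fun e : TotalSpace (TargetModel m n) (TargetBundle m n) =>
      (⟨e.1, (fiberIso e.1).symm e.2⟩ : TotalSpace (SourceModel m n) (SourceBundle m n)) := by
  refine continuous_symm_of_frames (F := SourceModel m n) fiberIso continuous_fiberIso
    continuous_target_proj targetCoord targetCoord_injective continuous_targetCoord fun b₀ => ?_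
  obtain ⟨s, hs⟩ := exists_mem_domain_etaCoord b₀
  let τ := trivializationAt (ModelE m n) (TangentSpace 𝓘(ℝ, ModelE m n) : PT m n → Type) b₀
  -- The second set is where `x_s ≠ 0`, so that `x_s`, an odd function, is a nowhere zero section of
  -- `η` there.
  refine ⟨sourceFrame τ s, τ.baseSet ∩ (etaCoord s).domain,
    τ.open_baseSet.inter (etaCoord s).isOpen_domain, ⟨mem_baseSet_trivializationAt _ _ _, hs⟩,
    fun b hb => sourceFrame_bijective τ s hb.1 (coord_ne_zero_of_mem_domain ?_),
    (continuousOn_sourceFrame τ s).mono (prod_mono inter_subset_left Subset.rfl)⟩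
  rw [PT.mk_lift]
  exact hb.2

end Iso

end

end ProjProd

theorem mainTheorem6 {k l : ℕ} [NeZero k] (m : Fin k → ℕ) (n : Fin l → ℕ) :
    IsRealVectorBundle ℝ (eta m n).Fiber ∧
    (∀ j, IsRealVectorBundle ℂ (zeta m n j).Fiber) ∧
    Nonempty (BundleIso
      ((ModelE m n × (Fin l → ℝ)) × (Fin (k + l) → ℝ))
      (((TangentSpace 𝓘(ℝ, ModelE m n) : PT m n → Type) ×ᵇ
        WhitneySum (fun _ : Fin l => (eta m n).Fiber)) ×ᵇ
        WhitneySum (fun _ : Fin (k + l) => Bundle.Trivial (PT m n) ℝ))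
      (((Σ i, Fin (m i + 1)) → ℝ) × ((Σ j, Fin (n j + 1)) → ℂ))
      (WhitneySum (fun _ : Σ i, Fin (m i + 1) => (eta m n).Fiber) ×ᵇ
        WhitneySum (fun s : Σ j, Fin (n j + 1) => (zeta m n s.1).Fiber))) :=
  ⟨isRealVectorBundle_eta, isRealVectorBundle_zeta,
    ⟨{ equiv := fiberIso
       continuous_toFun := continuous_fiberIso
       continuous_invFun := continuous_fiberIso_symm }⟩⟩
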